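/- Let $n \ge 2$ be an integer, $\alpha = \lfloor n/2 \rfloor$ and $BS(1,n) = \langle a,t \mid tat^{-1} = a^n \rangle$. Let $S_n(N)$ be the sphere of radius $N$ in $BS(1,n)$ with respect to the generating set $\{a,t\}$. Definitions. A sequence $f(N)$ of non-negative integers has growth rate $\lambda > 1$ if $\lim_{N\to\infty} \frac{\log f(N)}{N \log \lambda} = 1$ and $f(N) = \Theta(\lambda^N)$. The growth rate of $BS(1,n)$ is the growth rate of $|S_n(N)|$. For a finitely supported integer vector $\mathbf{x} = (x_0, x_1, \dots)$, let $k_{\mathbf{x}}$ be the index of its last nonzero digit ($k_{\mathbf 0} = 0$), and for $v \in \mathbb{Z}$ let $\mathcal{L}_v$ be the set of all such $\mathbf{x}$ with $\sum_i x_i n^i = v$. For integers $u, w \ge 0$ and $\mathbf{x} \in \mathcal{L}_v$ with $k = k_{\mathbf{x}}$, let $\eta_{u,v,w}(\mathbf{x})$ be the word $$t^{-u} a^{x_0} t a^{x_1} \cdots t a^{x_k} t^{w-k} \quad \text{if } k \le w \text{ (shape 1) or } u \le w < k \text{ (shape 3)},$$ $$t^{k-u} a^{x_k} t^{-1} a^{x_{k-1}}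 \cdots t^{-1} a^{x_0} t^{w} \quad \text{if } w < k \le u \text{ (shape 2) or } w < u < k \text{ (shape 4)},$$ and let $|\eta_{u,v,w}(\mathbf{x})|$ be its length, the sum of the absolute values of the displayed exponents (no cancellation is performed). Let $\mathcal{B}_v^{u,w}$ be the set of $\mathbf{x} \in \mathcal{L}_v$ such that $|x_i| \le \alpha$ for $i < k_{\mathbf{x}}$, and $|x_{k_{\mathbf{x}}}| \le \alpha$ if $k_{\mathbf{x}} < \max(u,w)$, while $|x_{k_{\mathbf{x}}}| \le \alpha + 1$ (or $\alpha + 2$ when $n = 2$) if $k_{\mathbf{x}} \ge \max(u,w)$. A vector $\mathbf{x} \in \mathcal{L}_v$ is minimal (for $u, v, w$) if $|\eta_{u,v,w}(\mathbf{x})| \le |\eta_{u,v,w}(\mathbf{y})|$ for all $\mathbf{y} \in \mathcal{L}_v$ and, when $n$ is even, $(|x_0|, |x_1|, \dots)$ is moreover lexicographically minimal (smaller-index digits being more significant) among the vectors of absolute values of all $\mathbf{y} \in \mathcal{L}_v$ of the same minimal $|\eta_{u,v,w}(\mathbf{y})|$. The language $\mathcal{O}_n$ of strict shape 1 geodesics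 is the set of geodesic words $\eta_{u,v,w}(\mathbf{x})$ where $u, w \ge 0$ and $v$ are integers such that $uw = 0$ if $n \mid v$ (so that $t^{-u}a^vt^w$ is a normal form), and $\mathbf{x} \in \mathcal{B}_v^{u,w}$ is minimal with $k_{\mathbf{x}} < w$. Let $\mathcal{O}_n(N)$ be the set of words of length $N$ in $\mathcal{O}_n$. Theorem. If $n$ is odd, the polynomial $$1 - x - \sum_{i=1}^{\alpha} 2x^{i+1}$$ has a unique complex root $r$ of smallest magnitude; this root is real with $0 < r < 1$, and both the sequence $|\mathcal{O}_n(N)|$ and the group $BS(1,n)$ have growth rate $1/r$. If $n$ is even, the same holds with the polynomial $$1 - 2x - x^2 + 2x^{\alpha+1} - 2x^{\alpha+2} + 2x^{2\alpha+2}.$$ -/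

import Mathlib

open Filter Topology Asymptotics
open scoped Polynomial

namespace BSGrowth

/-- The two generators of `BS(1,n)`. -/
inductive Gen : Type
  | a
  | t

/-- Words over `{a, a⁻¹, t, t⁻¹}`: the letter `(s, true)` stands for `s` and `(s, false)` stands
for `s⁻¹`. -/
abbrev Word : Type := List (Gen × Bool)

/-- The relator `t a t⁻¹ (aⁿ)⁻¹`. -/
def relator (n : ℕ) : FreeGroup Gen :=
  FreeGroup.of Gen.t * FreeGroup.of Gen.a * (FreeGroup.of Gen.t)⁻¹ * (FreeGroup.of Gen.a ^ n)⁻¹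

/-- The solvable Baumslag-Solitar group `BS(1,n) = ⟨a, t | t a t⁻¹ = aⁿ⟩`. -/
abbrev BS (n : ℕ) : Type := PresentedGroup ({relator n} : Set (FreeGroup Gen))

/-- The element of `BS(1,n)` represented by a word. -/
def wordEval (n : ℕ) (W : Word) : BS n :=
  PresentedGroup.mk ({relator n} : Set (FreeGroup Gen)) (FreeGroup.mk W)

/-- The word length of an element of `BS(1,n)` with respect to `{a, t}`. -/
noncomputable def wordLength (n : ℕ) (g : BS n) : ℕ :=
  sInf {m : ℕ | ∃ W : Word, wordEval n W = g ∧ W.length = m}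

/-- The sphere of radius `N` in `BS(1,n)`. -/
def sphere (n N : ℕ) : Set (BS n) := {g | wordLength n g = N}

/-- A word is geodesic if it is a shortest word representing its element. -/
def IsGeodesic (n : ℕ) (W : Word) : Prop := W.length = wordLength n (wordEval n W)

/-- The word `s^m`, for a generator `s` and an integer exponent `m`. -/
def powWord (s : Gen) (m : ℤ) : Word := List.replicate m.natAbs (s, decide (0 ≤ m))

/-- The word `a^{x_0} t a^{x_1} t ⋯ t a^{x_k}`. -/
def upWord (x : ℕ →₀ ℤ) : ℕ → Word
  | 0 => powWord Gen.a (x 0)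
  | k + 1 => upWord x k ++ (Gen.t, true) :: powWord Gen.a (x (k + 1))

/-- The word `a^{x_k} t⁻¹ a^{x_{k-1}} t⁻¹ ⋯ t⁻¹ a^{x_0}`. -/
def downWord (x : ℕ →₀ ℤ) : ℕ → Word
  | 0 => powWord Gen.a (x 0)
  | k + 1 => powWord Gen.a (x (k + 1)) ++ (Gen.t, false) :: downWord x k

/-- The index `k_x` of the last nonzero digit of `x` (equal to `0` if `x = 0`). -/
def lastIndex (x : ℕ →₀ ℤ) : ℕ := x.support.sup id

/-- The set `L_v` of digit vectors `x` with `∑ x_i nⁱ = v`. -/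
def digitLattice (n : ℕ) (v : ℤ) : Set (ℕ →₀ ℤ) :=
  {x | (x.sum fun i d => d * (n : ℤ) ^ i) = v}

/-- The path `η_{u,v,w}(x)` (where `v = ∑ x_i nⁱ` is determined by `x`). The four cases are the
shapes 1, 2, 3, 4, in this order. -/
def eta (u w : ℕ) (x : ℕ →₀ ℤ) : Word :=
  if lastIndex x ≤ w then
    powWord Gen.t (-(u : ℤ)) ++ upWord x (lastIndex x) ++
      powWord Gen.t ((w : ℤ) - (lastIndex x : ℤ))
  else if lastIndex x ≤ u then
    powWord Gen.t ((lastIndex x : ℤ) - (u : ℤ)) ++ downWord x (lastIndex x) ++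
      powWord Gen.t (w : ℤ)
  else if u ≤ w then
    powWord Gen.t (-(u : ℤ)) ++ upWord x (lastIndex x) ++
      powWord Gen.t ((w : ℤ) - (lastIndex x : ℤ))
  else
    powWord Gen.t ((lastIndex x : ℤ) - (u : ℤ)) ++ downWord x (lastIndex x) ++
      powWord Gen.t (w : ℤ)

/-- The condition under which `t^{-u} a^v t^w` is in normal form. -/
def IsNormalForm (n u : ℕ) (v : ℤ) (w : ℕ) : Prop := (n : ℤ) ∣ v → u * w = 0

/-- The box `B_v^{u,w}` of vectors of `L_v` with bounded digits. -/
def box (n u : ℕ) (v : ℤ) (w : ℕ) : Set (ℕ →₀ ℤ) :=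
  {x | x ∈ digitLattice n v ∧
    (∀ i < lastIndex x, |x i| ≤ ((n / 2 : ℕ) : ℤ)) ∧
    (lastIndex x < max u w → |x (lastIndex x)| ≤ ((n / 2 : ℕ) : ℤ)) ∧
    (max u w ≤ lastIndex x →
      |x (lastIndex x)| ≤ ((n / 2 : ℕ) : ℤ) + (if n = 2 then 2 else 1))}

/-- `(|x_i|)` is strictly smaller than `(|y_i|)` in the lexicographic order in which digits of
smaller index are more significant. -/
def AbsLexLT (x y : ℕ →₀ ℤ) : Prop :=
  ∃ i, (∀ j < i, |x j| = |y j|) ∧ |x i| < |y i|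

/-- Minimal vectors: `η_{u,v,w}(x)` is shortest among all `η_{u,v,w}(y)`, `y ∈ L_v`, and, for `n`
even, the vector of absolute values of `x` is lexicographically minimal among all such vectors. -/
def IsMinimalVector (n u : ℕ) (v : ℤ) (w : ℕ) (x : ℕ →₀ ℤ) : Prop :=
  x ∈ digitLattice n v ∧
  (∀ y ∈ digitLattice n v, (eta u w x).length ≤ (eta u w y).length) ∧
  (Even n → ∀ y ∈ digitLattice n v, (eta u w y).length = (eta u w x).length → ¬ AbsLexLT y x)

/-- The language `O_n` of strict shape 1 geodesics: the geodesic words `η_{u,v,w}(x)` given by a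
normal form `t^{-u} a^v t^w` and a minimal vector `x ∈ B_v^{u,w}` with `k_x < w`. -/
def strictShapeOneGeodesics (n : ℕ) : Set Word :=
  {W | ∃ (u : ℕ) (v : ℤ) (w : ℕ) (x : ℕ →₀ ℤ),
    IsNormalForm n u v w ∧ x ∈ box n u v w ∧ IsMinimalVector n u v w x ∧
    lastIndex x < w ∧ W = eta u w x ∧ IsGeodesic n W}

/-- The number of words of length `N` in the language `O_n`. -/
noncomputable def languageCount (n N : ℕ) : ℕ :=
  {W : Word | W ∈ strictShapeOneGeodesics n ∧ W.length = N}.ncard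

/-- The number of elements in the sphere of radius `N` of `BS(1,n)`. -/
noncomputable def sphereCount (n N : ℕ) : ℕ := (sphere n N).ncard

/-- The sequence `f` has (exponential) growth rate `lam > 1`:
`log f(N) / (N log lam) → 1`, and moreover `f(N) = Θ(lam ^ N)`. -/
def HasGrowthRate (f : ℕ → ℕ) (lam : ℝ) : Prop :=
  1 < lam ∧
  Tendsto (fun N : ℕ => Real.log (f N) / (N * Real.log lam)) atTop (𝓝 1) ∧
  (fun N : ℕ => (f N : ℝ)) =Θ[atTop] (fun N : ℕ => lam ^ N)

/-- `z₀` is the (unique) complex root of `p` of smallest magnitude. -/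
def IsSmallestRoot (p : ℤ[X]) (z₀ : ℂ) : Prop :=
  Polynomial.aeval z₀ p = 0 ∧
  ∀ z : ℂ, Polynomial.aeval z p = 0 → z ≠ z₀ → ‖z₀‖ < ‖z‖

/-- The polynomial `1 - x - ∑_{i=1}^α 2 x^{i+1}`, used for `n` odd. -/
noncomputable def oddPoly (α : ℕ) : ℤ[X] :=
  1 - Polynomial.X - ∑ i ∈ Finset.Icc 1 α, 2 * Polynomial.X ^ (i + 1)

/-- The polynomial `1 - 2x - x² + 2x^{α+1} - 2x^{α+2} + 2x^{2α+2}`, used for `n` even. -/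
noncomputable def evenPoly (α : ℕ) : ℤ[X] :=
  1 - 2 * Polynomial.X - Polynomial.X ^ 2 + 2 * Polynomial.X ^ (α + 1)
    - 2 * Polynomial.X ^ (α + 2) + 2 * Polynomial.X ^ (2 * α + 2)

end BSGrowth

/-!
An element of `BS(1,n)` acts on `ℚ` by an affine map, `a : y ↦ 1 + y` and `t : y ↦ n y`, and this
action is faithful (`wordEval_eq_iff`). A word walks along the levels `t^i`, adding `±1` to the
digit at the current level with each letter `a^{±1}`. So a word is described by the list of its
digits to base `n` and by an interval of levels that has to be covered (`exists_digits`); its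
length is at least the sum of the absolute values of the digits plus the length of the shortest
such walk.

The cheapest digit expansions form a free monoid on a finite set of blocks. For `n` odd the blocks
are the digits `r` with `|r| ≤ α`. For `n` even they are the digits with `|r| < α` and the pairs
`(α, e)` and `(-α, -e)` with `0 ≤ e < α`, because `α` and a digit `f` above it can be traded for
`-α` and `f + 1`. The properties of such a family are collected in `IsDigitCode`. Every digit list
can be normalized to a concatenation of blocks and a carry without becoming more expensive
(`IsDigitCode.exists_spell`); conversely a concatenation of blocks is cheapest among all
expansions of its value (`IsDigitCode.digitNorm_spell_le`), unique, and lexicographically minimal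
(`IsDigitCode.eq_or_listAbsLexLT`).

Let `Q(x) = ∑ x^{weight}` over the blocks, the weight of a block being the length of the subword
which writes it. The polynomial of the theorem is `1 - Q` for `n` odd and `(1 - x)(1 - Q)` for `n`
even. If `Q(r) = 1` with `0 < r < 1`, the number of concatenations of blocks of weight `N` is
`Θ(r^{-N})`, by the recursion that removes the first block. As `Q` has nonnegative coefficients
and contains `x`, the root `r` is strictly smaller than the absolute value of any other root.

Lower bound: the words `a^{x_0} t ⋯ a^{x_{w-1}} t`, with `x` a concatenation of blocks, are strict
shape 1 geodesics and represent distinct elements. Upper bound: an element of the sphere of radius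
`N` is determined by a concatenation of blocks, a top digit, the numbers of levels covered below
and above the two ends of the walk, and finitely many further choices, of total weight at most `N
+ 2`; an additional parameter in `ℕ` that is weighted by its value does not change the order of
growth (`IsExpBounded.prod_nat`). Finally the strict shape 1 geodesics are at most as many as the
elements of the sphere, since an element is represented by at most one of them
(`wordEval_injOn_strictShapeOneGeodesics`).
-/

namespace BSGrowth

/-! ### Digit lists -/

/-- The integer `∑ dᵢ nⁱ` written by a list of digits, the least significant digit first. -/
def digitValue (n : ℕ) : List ℤ → ℤ
  | [] => 0
  | d :: l => d + n * digitValue n l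

/-- The sum of the absolute values of the digits: the number of letters `a^{±1}` spent on them. -/
def digitNorm (l : List ℤ) : ℕ := (l.map Int.natAbs).sum

@[simp] lemma digitValue_nil (n : ℕ) : digitValue n [] = 0 := rfl

@[simp] lemma digitValue_cons (n : ℕ) (d : ℤ) (l : List ℤ) :
    digitValue n (d :: l) = d + n * digitValue n l := rfl

@[simp] lemma digitNorm_nil : digitNorm [] = 0 := rfl

@[simp] lemma digitNorm_cons (d : ℤ) (l : List ℤ) :
    digitNorm (d :: l) = d.natAbs + digitNorm l := by
  simp [digitNorm]

lemma digitValue_append (n : ℕ) (l₁ l₂ : List ℤ) :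
    digitValue n (l₁ ++ l₂) = digitValue n l₁ + (n : ℤ) ^ l₁.length * digitValue n l₂ := by
  induction l₁ with
  | nil => simp
  | cons d l ih => simp only [List.cons_append, digitValue_cons, ih, List.length_cons]; ring

lemma digitNorm_append (l₁ l₂ : List ℤ) :
    digitNorm (l₁ ++ l₂) = digitNorm l₁ + digitNorm l₂ := by
  simp [digitNorm]

/-- The absolute values of the digits of `x` are lexicographically smaller than those of `y`; both
lists are extended by zeros. -/
def ListAbsLexLT (x y : List ℤ) : Prop :=
  ∃ i, (∀ j < i, (x.getD j 0).natAbs = (y.getD j 0).natAbs) ∧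
    (x.getD i 0).natAbs < (y.getD i 0).natAbs

lemma not_listAbsLexLT_symm {x y : List ℤ} (h : ListAbsLexLT x y) : ¬ ListAbsLexLT y x := by
  rintro ⟨j, hj, hj'⟩
  obtain ⟨i, hi, hi'⟩ := h
  rcases lt_trichotomy i j with hij | rfl | hij
  · have := hj i hij; omega
  · omega
  · have := hi j hij; omega

lemma ListAbsLexLT.append {x y : List ℤ} (h : ListAbsLexLT x y) (hl : y.length = x.length)
    (x' y' : List ℤ) : ListAbsLexLT (x ++ x') (y ++ y') := by
  obtain ⟨i, hi, hi'⟩ := h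
  have hlt : i < y.length := by
    by_contra hge
    rw [List.getD_eq_default y _ (not_lt.1 hge)] at hi'
    exact absurd hi' (Nat.not_lt_zero _)
  refine ⟨i, fun j hj => ?_, ?_⟩
  · rw [List.getD_append _ _ _ _ (by omega), List.getD_append _ _ _ _ (by omega)]
    exact hi j hj
  · rw [List.getD_append _ _ _ _ (by omega), List.getD_append _ _ _ _ (by omega)]
    exact hi'

lemma ListAbsLexLT.append_left {x y : List ℤ} (h : ListAbsLexLT x y) (b : List ℤ) :
    ListAbsLexLT (b ++ x) (b ++ y) := by
  obtain ⟨i, hi, hi'⟩ := h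
  refine ⟨b.length + i, fun j hj => ?_, ?_⟩
  · rcases lt_or_ge j b.length with hjb | hjb
    · rw [List.getD_append _ _ _ _ hjb, List.getD_append _ _ _ _ hjb]
    · rw [List.getD_append_right _ _ _ _ hjb, List.getD_append_right _ _ _ _ hjb]
      exact hi _ (by omega)
  · rw [List.getD_append_right _ _ _ _ (by omega), List.getD_append_right _ _ _ _ (by omega)]
    simpa using hi'

/-! ### Digit codes -/

/-- A finite family of blocks of digits such that every integer has, up to a carry, exactly one
expansion to base `n` that is a concatenation of blocks, and this expansion is the cheapest one.
By `cover`, any two digits `h, f` begin with a block, up to a carry into the next position.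
The fields `cost_le` and `lex` compare a block with an arbitrary digit list `d` of the same length
and the same value up to a carry `c`. -/
structure IsDigitCode (n : ℕ) {ι : Type} [Fintype ι] (blk : ι → List ℤ) : Prop where
  zero : ∃ i, blk i = [0]
  one_lt_card : 1 < Fintype.card ι
  ne_nil : ∀ i, blk i ≠ []
  natAbs_le : ∀ i, ∀ d ∈ blk i, d.natAbs ≤ n / 2
  prefix_free : ∀ i j, blk i <+: blk j → i = j
  cover : ∀ h f : ℤ, (∃ i c, (blk i).length = 1 ∧ h = digitValue n (blk i) + n * c) ∨
    ∃ i c, (blk i).length = 2 ∧ h + n * f = digitValue n (blk i) + (n : ℤ) ^ 2 * c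
  cost_le : ∀ i c d, d.length = (blk i).length →
    digitValue n d = digitValue n (blk i) + (n : ℤ) ^ (blk i).length * c →
    digitNorm (blk i) + c.natAbs ≤ digitNorm d
  lex : ∀ i c d, d.length = (blk i).length →
    digitValue n d = digitValue n (blk i) + (n : ℤ) ^ (blk i).length * c →
    d = blk i ∨ ListAbsLexLT (blk i) d

/-- The concatenation of a list of blocks. -/
def spell {ι : Type} (blk : ι → List ℤ) (L : List ι) : List ℤ := (L.map blk).flatten

section spell

variable {ι : Type} (blk : ι → List ℤ)

@[simp] lemma spell_nil : spell blk [] = [] := rfl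

@[simp] lemma spell_cons (i : ι) (L : List ι) : spell blk (i :: L) = blk i ++ spell blk L := by
  simp [spell]

lemma spell_replicate_zero {i : ι} (hi : blk i = [0]) (k : ℕ) :
    spell blk (List.replicate k i) = List.replicate k 0 := by
  induction k with
  | zero => rfl
  | succ k ih => simp [List.replicate_succ, ih, hi]

lemma spell_append (L L' : List ι) : spell blk (L ++ L') = spell blk L ++ spell blk L' := by
  simp [spell]

end spell

namespace IsDigitCode

variable {n : ℕ} {ι : Type} [Fintype ι] {blk : ι → List ℤ}

lemma spell_injective (hP : IsDigitCode n blk) : Function.Injective (spell blk) := by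
  intro L
  induction L with
  | nil =>
    intro L' h
    cases L' with
    | nil => rfl
    | cons j L' => simp [hP.ne_nil j] at h
  | cons i L ih =>
    intro L' h
    cases L' with
    | nil => simp [hP.ne_nil i] at h
    | cons j L' =>
      simp only [spell_cons] at h
      have hij : i = j := by
        rcases List.prefix_or_prefix_of_prefix (l₁ := blk i) (l₂ := blk j)
          (l₃ := blk i ++ spell blk L) (List.prefix_append _ _) (h ▸ List.prefix_append _ _)
          with h1 | h1
        · exact hP.prefix_free _ _ h1
        · exact (hP.prefix_free _ _ h1).symm
      subst hij
      rw [ih (List.append_cancel_left h)]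

/-- Normalization from the least significant digit upwards: the blocks are read off one by one, and
the carry goes into the next digit. The last block may use one position more than `d`. -/
lemma exists_spell (hP : IsDigitCode n blk) : ∀ (d : List ℤ) (c : ℤ), ∃ (L : List ι) (c' : ℤ),
    c + digitValue n d = digitValue n (spell blk L) + (n : ℤ) ^ (spell blk L).length * c' ∧
    digitNorm (spell blk L) + c'.natAbs ≤ c.natAbs + digitNorm d ∧
    ((spell blk L).length = d.length ∨ (spell blk L).length = d.length + 1)
  | [], c => ⟨[], c, by simp⟩
  | h :: t, c => by
    rcases hP.cover (c + h) (t.headD 0) with ⟨i, e, hl, he⟩ | ⟨i, e, hl, he⟩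
    · have hc := hP.cost_le i e [c + h] (by simp [hl]) (by simp [hl, he])
      obtain ⟨L, c', h1, h2, h3⟩ := exists_spell hP t e
      refine ⟨i :: L, c', ?_, ?_, ?_⟩
      · simp only [spell_cons, digitValue_append, digitValue_cons, List.length_append, hl]
        rw [← add_assoc, he, pow_add]
        linear_combination (n : ℤ) * h1
      · simp only [spell_cons, digitNorm_append, digitNorm_cons, digitNorm_nil] at hc ⊢
        omega
      · simp only [spell_cons, List.length_append, List.length_cons, hl]
        omega
    · have hc := hP.cost_le i e [c + h, t.headD 0] (by simp [hl]) (by simpa [hl] using he)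
      match t with
      | [] =>
        simp only [List.headD_nil, mul_zero, add_zero] at he
        refine ⟨[i], e, ?_, ?_, ?_⟩
        · simp [hl, he]
        · simp at hc ⊢
          omega
        · simp [hl]
      | h' :: t' =>
        obtain ⟨L, c', h1, h2, h3⟩ := exists_spell hP t' e
        simp only [List.headD_cons] at he hc
        refine ⟨i :: L, c', ?_, ?_, ?_⟩
        · simp only [spell_cons, digitValue_append, digitValue_cons, List.length_append, hl]
          rw [pow_add]
          linear_combination he + (n : ℤ) ^ 2 * h1
        · simp only [spell_cons, digitNorm_append, digitNorm_cons, digitNorm_nil] at hc ⊢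
          omega
        · simp only [spell_cons, List.length_append, List.length_cons, hl]
          omega
  termination_by d => d.length

/-- Block expansions are cheapest: a digit list `d` writing the same value has at least their norm.
The incoming carry `c` makes the induction work. -/
lemma digitNorm_spell_le (hP : IsDigitCode n blk) (L : List ι) :
    ∀ (d : List ℤ) (c : ℤ), (spell blk L).length ≤ d.length →
      c + digitValue n d = digitValue n (spell blk L) →
    digitNorm (spell blk L) ≤ c.natAbs + digitNorm d := by
  induction L with
  | nil => simp
  | cons i L ih =>
    intro d c hlen hval
    have hpos := List.length_pos_of_ne_nil (hP.ne_nil i)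
    simp only [spell_cons, List.length_append, digitValue_append, digitNorm_append] at *
    obtain ⟨h, t, rfl⟩ := List.exists_cons_of_length_pos (show 0 < d.length by omega)
    -- the carry is absorbed by the lowest digit
    obtain ⟨e, he⟩ : ∃ e, e = (c + h) :: t := ⟨_, rfl⟩
    have hsplit := List.take_append_drop (blk i).length e
    have hlt : (e.take (blk i).length).length = (blk i).length := by
      rw [List.length_take, min_eq_left]; rw [he]; simp at hlen ⊢; omega
    have hv : digitValue n e = c + digitValue n (h :: t) := by simp [he]; ring
    have hnorm : digitNorm e ≤ c.natAbs + digitNorm (h :: t) := by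
      simp [he]; omega
    rw [← hsplit, digitValue_append, hlt] at hv
    rw [← hsplit, digitNorm_append] at hnorm
    have h1 := hP.cost_le i (digitValue n (spell blk L) - digitValue n (e.drop (blk i).length))
      _ hlt (by linear_combination hv + hval)
    have h2 := ih (e.drop (blk i).length)
      (digitValue n (spell blk L) - digitValue n (e.drop (blk i).length))
      (by rw [List.length_drop, he]; simp at hlen ⊢; omega) (by ring)
    omega

/-- Block expansions are unique, and lexicographically smallest in absolute value among all
expansions of the same value. -/
lemma eq_or_listAbsLexLT (hP : IsDigitCode n blk) (hn : n ≠ 0) (L : List ι) : ∀ d : List ℤ,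
    (spell blk L).length ≤ d.length → digitValue n d = digitValue n (spell blk L) →
    (∀ i, (spell blk L).getD i 0 = d.getD i 0) ∨ ListAbsLexLT (spell blk L) d := by
  induction L with
  | nil =>
    intro d _ _
    by_cases h : ∀ i, d.getD i 0 = 0
    · left; intro i; simpa using (h i).symm
    · right
      push Not at h
      classical
      refine ⟨Nat.find h, fun j hj => ?_, ?_⟩
      · have := Nat.find_min h hj
        push Not at this
        rw [this]; simp
      · have := Nat.find_spec h
        simpa [Int.natAbs_pos] using this
  | cons i L ih =>
    intro d hlen hval
    simp only [spell_cons, List.length_append, digitValue_append] at *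
    have hsplit := List.take_append_drop (blk i).length d
    have hlt : (d.take (blk i).length).length = (blk i).length := by
      rw [List.length_take, min_eq_left]; omega
    have hld : (spell blk L).length ≤ (d.drop (blk i).length).length := by
      rw [List.length_drop]; omega
    generalize d.take (blk i).length = d₁ at *
    generalize d.drop (blk i).length = d₂ at *
    subst hsplit
    rw [digitValue_append, hlt] at hval
    rcases hP.lex i (digitValue n (spell blk L) - digitValue n d₂) d₁ hlt
      (by linear_combination hval) with rfl | h
    · rcases ih d₂ hld (mul_left_cancel₀ (pow_ne_zero (blk i).length (Nat.cast_ne_zero.2 hn))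
        (add_left_cancel hval)) with h | h
      · left
        intro j
        rcases lt_or_ge j (blk i).length with hjb | hjb
        · rw [List.getD_append _ _ _ _ hjb, List.getD_append _ _ _ _ hjb]
        · rw [List.getD_append_right _ _ _ _ hjb, List.getD_append_right _ _ _ _ hjb]
          exact h _
      · exact Or.inr (h.append_left _)
    · exact Or.inr (h.append hlt _ _)

end IsDigitCode

/-! ### The two digit codes -/

lemma natAbs_add_natAbs_le {n : ℕ} {r c : ℤ} (hr : 2 * r.natAbs + 1 ≤ n) :
    r.natAbs + c.natAbs ≤ (r + n * c).natAbs := by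
  rcases eq_or_ne c 0 with rfl | hc
  · simp
  have h1 : 1 ≤ c.natAbs := Int.natAbs_pos.2 hc
  have h2 : 2 * r.natAbs + c.natAbs ≤ n * c.natAbs := by
    nlinarith [Nat.mul_le_mul_right c.natAbs hr, Nat.mul_le_mul_left (2 * r.natAbs) h1]
  have h3 : (n * c : ℤ).natAbs = n * c.natAbs := by rw [Int.natAbs_mul, Int.natAbs_natCast]
  omega

/-- For `n` odd the blocks are the single digits `r` with `|r| ≤ α`. -/
def oddBlock (n : ℕ) (r : ↥(Finset.Icc (-((n / 2 : ℕ) : ℤ)) ((n / 2 : ℕ) : ℤ))) : List ℤ := [r.1]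

lemma isDigitCode_oddBlock {n : ℕ} (hn : 2 ≤ n) (hodd : Odd n) : IsDigitCode n (oddBlock n) where
  zero := ⟨⟨0, by simp only [Finset.mem_Icc]; omega⟩, rfl⟩
  one_lt_card := by
    rw [Fintype.card_coe, Int.card_Icc]
    omega
  ne_nil i := by simp [oddBlock]
  natAbs_le i d hd := by
    obtain ⟨r, hr⟩ := i
    have hr' := Finset.mem_Icc.1 hr
    simp only [oddBlock, List.mem_singleton] at hd
    omega
  prefix_free i j h := by
    simp only [oddBlock] at h
    exact Subtype.ext (by simpa using h)
  cover h f := by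
    left
    obtain ⟨k, hk⟩ := hodd
    have h0 := Int.emod_nonneg h (show (n : ℤ) ≠ 0 by omega)
    have h1 := Int.emod_lt_of_pos h (show (0 : ℤ) < n by omega)
    have h2 := Int.emod_add_mul_ediv h n
    by_cases hr : h % n ≤ k
    · exact ⟨⟨h % n, by simp only [Finset.mem_Icc]; omega⟩, h / n, rfl, by simp [oddBlock, h2]⟩
    · refine ⟨⟨h % n - n, by simp only [Finset.mem_Icc]; omega⟩, h / n + 1, rfl, ?_⟩
      simp only [oddBlock, digitValue_cons, digitValue_nil]
      linear_combination -h2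
  cost_le i c d hd hv := by
    obtain ⟨k, hk⟩ := hodd
    obtain ⟨r, hr⟩ := i
    have hr' := Finset.mem_Icc.1 hr
    obtain ⟨h, rfl⟩ := List.length_eq_one_iff.1 hd
    simp [oddBlock] at hv ⊢
    subst hv
    exact natAbs_add_natAbs_le (by omega)
  lex i c d hd hv := by
    obtain ⟨k, hk⟩ := hodd
    obtain ⟨r, hr⟩ := i
    have hr' := Finset.mem_Icc.1 hr
    obtain ⟨h, rfl⟩ := List.length_eq_one_iff.1 hd
    simp [oddBlock] at hv ⊢
    rcases eq_or_ne c 0 with rfl | hc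
    · left; simpa using hv
    · right
      refine ⟨0, by simp, ?_⟩
      have := natAbs_add_natAbs_le (n := n) (r := r) (c := c) (by omega)
      simp only [List.getD_cons_zero, hv]
      omega

/-- For `n` even the blocks are the single digits `r` with `|r| < α` and the pairs `(α, e)` and
`(-α, -e)` with `0 ≤ e < α`: a digit `±α` can be traded for `∓α` and a carry, so that its sign is
to be decided by the next digit. -/
def evenBlock (n : ℕ) :
    ↥(Finset.Ioo (-((n / 2 : ℕ) : ℤ)) ((n / 2 : ℕ) : ℤ)) ⊕ (Bool × Fin (n / 2)) → List ℤ
  | .inl r => [r.1]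
  | .inr (true, e) => [((n / 2 : ℕ) : ℤ), (e : ℤ)]
  | .inr (false, e) => [-((n / 2 : ℕ) : ℤ), -(e : ℤ)]

/-- The cost comparison for a block `(α, e)`, with `k` the carry between its digits. -/
lemma pair_cost_le {α : ℕ} {e k c : ℤ} (he : 0 ≤ e) (heα : e < α) :
    α + e.natAbs + c.natAbs ≤
      ((α : ℤ) + (2 * α : ℕ) * k).natAbs + (e + (2 * α : ℕ) * c - k).natAbs := by
  have h1 := natAbs_add_natAbs_le (n := 2 * α) (r := e) (c := c)
    (by omega)
  have hα : (1 : ℤ) ≤ α := by omega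
  rcases lt_or_ge k 0 with hk | hk
  · rcases eq_or_ne k (-1) with rfl | hk1
    · have h2 : e.natAbs + c.natAbs ≤ (e + (2 * α : ℕ) * c - -1).natAbs := by
        push_cast
        rcases le_or_gt 0 c with hc | hc
        · have : c ≤ 2 * (α : ℤ) * c := by nlinarith
          omega
        · have : (2 * (α : ℤ) - 1) * c ≤ (2 * (α : ℤ) - 1) * (-1) := by
            apply mul_le_mul_of_nonneg_left <;> omega
          have h3 : 2 * (α : ℤ) * c ≤ c + 1 - 2 * α := by linarith
          omega
      push_cast at h2 ⊢
      omega
    · have : (α : ℤ) * (k + 1) ≤ 1 * (k + 1) := by nlinarith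
      have h3 : 2 * (α : ℤ) * k ≤ 2 * k + 2 - 2 * α := by linarith
      push_cast at h1 ⊢
      omega
  · have : k ≤ 2 * (α : ℤ) * k := by nlinarith
    push_cast at h1 ⊢
    omega

/-- The lexicographic comparison for a block `(α, e)`: trading `α` for `-α` makes the next digit
larger in absolute value. -/
lemma pair_lex {α : ℕ} {e k c : ℤ} (he : 0 ≤ e) (heα : e < α) :
    (k = 0 ∧ c = 0) ∨ α < ((α : ℤ) + (2 * α : ℕ) * k).natAbs ∨
      (α = ((α : ℤ) + (2 * α : ℕ) * k).natAbs ∧ e.natAbs < (e + (2 * α : ℕ) * c - k).natAbs) := by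
  have hα : (1 : ℤ) ≤ α := by omega
  rcases lt_trichotomy k 0 with hk | rfl | hk
  · right
    rcases eq_or_ne k (-1) with rfl | hk1
    · right
      push_cast
      refine ⟨by omega, ?_⟩
      rcases le_or_gt 0 c with hc | hc
      · have : 0 ≤ 2 * (α : ℤ) * c := by nlinarith
        omega
      · have : (α : ℤ) * c ≤ α * (-1) := by nlinarith
        have h3 : 2 * (α : ℤ) * c ≤ - 2 * α := by linarith
        omega
    · left
      have : (α : ℤ) * k ≤ α * (-2) := mul_le_mul_of_nonneg_left (by omega) (by omega)
      have h3 : 2 * (α : ℤ) * k ≤ - 4 * α := by linarith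
      push_cast
      omega
  · rcases eq_or_ne c 0 with rfl | hc
    · simp
    right; right
    have h1 := natAbs_add_natAbs_le (n := 2 * α) (r := e) (c := c)
      (by omega)
    push_cast at h1 ⊢
    omega
  · right; left
    have : 0 < 2 * (α : ℤ) * k := by positivity
    push_cast
    omega

lemma isDigitCode_evenBlock {n : ℕ} (hn : 2 ≤ n) (heven : Even n) :
    IsDigitCode n (evenBlock n) := by
  obtain ⟨α, rfl⟩ := heven.exists_two_nsmul
  simp only [smul_eq_mul] at *
  have hα : 2 * α / 2 = α := by omega
  have hα1 : 1 ≤ α := by omega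
  -- a pair of digits with the value of a block `(±α, ±e)` differs from it by carries `k` and `c`
  have hcarry : ∀ s e c h f : ℤ, h + (2 * α : ℕ) * f = s + (2 * α : ℕ) * e + (2 * α : ℕ) ^ 2 * c →
      ∃ k, h = s + (2 * α : ℕ) * k ∧ f = e + (2 * α : ℕ) * c - k := fun s e c h f hv =>
    ⟨e + (2 * α : ℕ) * c - f, by linear_combination hv, by ring⟩
  refine ⟨⟨.inl ⟨0, by simp [hα]; omega⟩, rfl⟩, ?_, ?_, ?_, ?_, ?_, ?_, ?_⟩
  · rw [Fintype.card_sum, Fintype.card_coe, Fintype.card_prod, Int.card_Ioo]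
    simp [hα]
    omega
  · rintro (r | ⟨_ | _, e⟩) <;> simp [evenBlock]
  · rintro (⟨r, hr⟩ | ⟨_ | _, e, he⟩) d hd <;> simp only [evenBlock, List.mem_cons,
      List.not_mem_nil, or_false] at hd
    · have hr' := Finset.mem_Ioo.1 hr
      omega
    all_goals omega
  · rintro (⟨r, hr⟩ | ⟨_ | _, e, he⟩) (⟨r', hr'⟩ | ⟨_ | _, e', he'⟩) h <;>
      (try have hr₁ := Finset.mem_Ioo.1 hr) <;> (try have hr₂ := Finset.mem_Ioo.1 hr') <;>
      simp [evenBlock, List.cons_prefix_cons] at h ⊢ <;> omega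
  · intro h f
    have h0 := Int.emod_nonneg h (show ((2 * α : ℕ) : ℤ) ≠ 0 by omega)
    have h1 := Int.emod_lt_of_pos h (show (0 : ℤ) < (2 * α : ℕ) by omega)
    have h2 := Int.emod_add_mul_ediv h (2 * α : ℕ)
    generalize h % (2 * α : ℕ) = r at *
    generalize h / (2 * α : ℕ) = q at *
    rcases lt_trichotomy r α with hr | rfl | hr
    · left
      exact ⟨.inl ⟨r, by simp only [Finset.mem_Ioo]; omega⟩, q, rfl, by simp [evenBlock, ← h2]⟩
    · right
      have g0 := Int.emod_nonneg (f + q) (show ((2 * α : ℕ) : ℤ) ≠ 0 by omega)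
      have g1 := Int.emod_lt_of_pos (f + q) (show (0 : ℤ) < (2 * α : ℕ) by omega)
      have g2 := Int.emod_add_mul_ediv (f + q) (2 * α : ℕ)
      generalize (f + q) % (2 * α : ℕ) = e at *
      generalize (f + q) / (2 * α : ℕ) = c at *
      by_cases he : e < α
      · refine ⟨.inr (true, ⟨e.toNat, by omega⟩), c, rfl, ?_⟩
        simp only [evenBlock, digitValue_cons, digitValue_nil, hα, Int.toNat_of_nonneg g0]
        linear_combination -h2 - (2 * α : ℕ) * g2
      · refine ⟨.inr (false, ⟨(2 * α - 1 - e).toNat, by omega⟩), c + 1, rfl, ?_⟩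
        simp only [evenBlock, digitValue_cons, digitValue_nil, hα,
          Int.toNat_of_nonneg (show 0 ≤ 2 * (α : ℤ) - 1 - e by omega)]
        push_cast at h2 g2 ⊢
        linear_combination -h2 - 2 * α * g2
    · left
      refine ⟨.inl ⟨r - (2 * α : ℕ), by simp only [Finset.mem_Ioo]; omega⟩, q + 1, rfl, ?_⟩
      simp only [evenBlock, digitValue_cons, digitValue_nil, ← h2]
      ring
  · rintro (⟨r, hr⟩ | ⟨_ | _, e, he⟩) c d hd hv
    · have hr' := Finset.mem_Ioo.1 hr
      obtain ⟨h, rfl⟩ := List.length_eq_one_iff.1 hd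
      simp only [evenBlock, digitValue_cons, digitValue_nil, digitNorm_cons, digitNorm_nil,
        mul_zero, add_zero, List.length_singleton, pow_one] at hv ⊢
      subst hv
      exact natAbs_add_natAbs_le (by omega)
    · obtain ⟨h, f, rfl⟩ := List.length_eq_two.1 hd
      simp [evenBlock] at hv
      obtain ⟨k, rfl, rfl⟩ := hcarry (-α) (-e) c h f (by push_cast; linarith)
      have := pair_cost_le (α := α) (e := e) (k := -k) (c := -c) (by omega) (by omega)
      have e1 : (-(α : ℤ) + (2 * α : ℕ) * k) = -(α + (2 * α : ℕ) * -k) := by ring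
      have e2 : (-(e : ℤ) + (2 * α : ℕ) * c - k) = -(e + (2 * α : ℕ) * -c - -k) := by ring
      simp only [evenBlock, digitNorm_cons, digitNorm_nil, hα]
      rw [e1, e2]
      simp only [Int.natAbs_neg, Int.natAbs_natCast] at this ⊢
      omega
    · obtain ⟨h, f, rfl⟩ := List.length_eq_two.1 hd
      simp [evenBlock] at hv
      obtain ⟨k, rfl, rfl⟩ := hcarry α e c h f (by push_cast; linarith)
      have := pair_cost_le (α := α) (e := e) (k := k) (c := c) (by omega) (by omega)
      simp only [evenBlock, digitNorm_cons, digitNorm_nil, hα]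
      simp only [Int.natAbs_natCast] at this ⊢
      omega
  · rintro (⟨r, hr⟩ | ⟨_ | _, e, he⟩) c d hd hv
    · have hr' := Finset.mem_Ioo.1 hr
      obtain ⟨h, rfl⟩ := List.length_eq_one_iff.1 hd
      simp only [evenBlock, digitValue_cons, digitValue_nil,
        mul_zero, add_zero, List.length_singleton, pow_one] at hv ⊢
      rcases eq_or_ne c 0 with rfl | hc
      · left; simpa using hv
      · right
        refine ⟨0, by simp, ?_⟩
        have := natAbs_add_natAbs_le (n := 2 * α) (r := r) (c := c) (by omega)
        simp only [List.getD_cons_zero, hv]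
        omega
    · obtain ⟨h, f, rfl⟩ := List.length_eq_two.1 hd
      simp [evenBlock] at hv
      obtain ⟨k, rfl, rfl⟩ := hcarry (-α) (-e) c h f (by push_cast; linarith)
      have e1 : (-(α : ℤ) + (2 * α : ℕ) * k) = -(α + (2 * α : ℕ) * -k) := by ring
      have e2 : (-(e : ℤ) + (2 * α : ℕ) * c - k) = -(e + (2 * α : ℕ) * -c - -k) := by ring
      rw [e1, e2]
      simp only [evenBlock, hα]
      rcases pair_lex (α := α) (e := e) (k := -k) (c := -c) (by omega) (by omega)
        with ⟨h1, h2⟩ | h1 | ⟨h1, h2⟩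
      · left; simp [h1, h2]
      · right; refine ⟨0, by simp, ?_⟩
        simp only [List.getD_cons_zero]; omega
      · right; refine ⟨1, ?_, ?_⟩
        · simp only [Nat.lt_one_iff, forall_eq, List.getD_cons_zero]; omega
        · simp only [List.getD_cons_zero, List.getD_cons_succ]; omega
    · obtain ⟨h, f, rfl⟩ := List.length_eq_two.1 hd
      simp [evenBlock] at hv
      obtain ⟨k, rfl, rfl⟩ := hcarry α e c h f (by push_cast; linarith)
      simp only [evenBlock, hα]
      rcases pair_lex (α := α) (e := e) (k := k) (c := c) (by omega) (by omega)
        with ⟨h1, h2⟩ | h1 | ⟨h1, h2⟩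
      · left; simp [h1, h2]
      · right; refine ⟨0, by simp, ?_⟩
        simp only [List.getD_cons_zero]; omega
      · right; refine ⟨1, ?_, ?_⟩
        · simp only [Nat.lt_one_iff, forall_eq, List.getD_cons_zero]; omega
        · simp only [List.getD_cons_zero, List.getD_cons_succ]; omega

/-! ### Counting weighted lists -/

section Counting

variable {ι : Type} [Fintype ι] {w : ι → ℕ} {r : ℝ}

/-- The number of lists over `ι` of total weight `N`. -/
noncomputable def listCount (w : ι → ℕ) (N : ℕ) : ℕ :=
  Nat.card {L : List ι // (L.map w).sum = N}

lemma finite_list_sum_le (hw : ∀ i, 1 ≤ w i) (K : ℕ) : {L : List ι | (L.map w).sum ≤ K}.Finite := by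
  refine (List.finite_length_le ι K).subset fun L (hL : (L.map w).sum ≤ K) => ?_
  refine le_trans ?_ hL
  clear hL
  induction L with
  | nil => simp
  | cons i L ih => have := hw i; simp only [List.length_cons, List.map_cons, List.sum_cons]; omega

lemma finite_list_sum_eq (hw : ∀ i, 1 ≤ w i) (K : ℕ) : {L : List ι | (L.map w).sum = K}.Finite :=
  (finite_list_sum_le hw K).subset fun _ hL => le_of_eq hL

/-- A nonempty list of weight `N` is a first letter followed by a list of the remaining weight. -/
lemma listCount_eq_sum (hw : ∀ i, 1 ≤ w i) {N : ℕ} (hN : 1 ≤ N) :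
    listCount w N = ∑ i, if w i ≤ N then listCount w (N - w i) else 0 := by
  have hfin : ∀ K, Finite {L : List ι // (L.map w).sum = K} := fun K =>
    (finite_list_sum_eq hw K).to_subtype
  let e : {L : List ι // (L.map w).sum = N} ≃
      (Σ i, {L : List ι // w i + (L.map w).sum = N}) :=
    { toFun := fun L => match L with
        | ⟨[], h⟩ => absurd h (by simp; omega)
        | ⟨i :: L, h⟩ => ⟨i, L, by simpa using h⟩
      invFun := fun p => ⟨p.1 :: p.2.1, by simpa using p.2.2⟩
      left_inv := by
        rintro ⟨_ | ⟨i, L⟩, h⟩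
        · exact absurd h (by simp; omega)
        · rfl
      right_inv := fun p => rfl }
  have hfin' : ∀ i, Finite {L : List ι // w i + (L.map w).sum = N} := fun i =>
    ((finite_list_sum_le hw N).subset fun L (hL : w i + (L.map w).sum = N) => by
      simp only [Set.mem_ofPred_eq]; omega).to_subtype
  rw [listCount, Nat.card_congr e, Nat.card_sigma]
  refine Finset.sum_congr rfl fun i _ => ?_
  split_ifs with hi
  · exact Nat.card_congr (Equiv.subtypeEquivRight fun L => by omega)
  · rw [Nat.card_eq_zero]
    exact Or.inl ⟨fun L => hi (by have := L.2; omega)⟩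

lemma listCount_mul_pow_le (hw : ∀ i, 1 ≤ w i) (hr : 0 < r) (hsum : ∑ i, r ^ w i = 1) (N : ℕ) :
    listCount w N * r ^ N ≤ 1 := by
  induction N using Nat.strong_induction_on with
  | _ N ih =>
    rcases Nat.eq_zero_or_pos N with rfl | hN
    · have : listCount w 0 ≤ 1 := by
        have hss : Subsingleton {L : List ι // (L.map w).sum = 0} := by
          have hnil : ∀ L : List ι, (L.map w).sum = 0 → L = [] := by
            rintro (_ | ⟨i, L⟩) h
            · rfl
            · have := hw i
              simp at h
              omega
          exact ⟨fun L L' => Subtype.ext (by rw [hnil _ L.2, hnil _ L'.2])⟩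
        exact Finite.card_le_one_iff_subsingleton.2 hss
      simpa using this
    · rw [listCount_eq_sum hw hN, ← hsum, Nat.cast_sum, Finset.sum_mul]
      refine Finset.sum_le_sum fun i _ => ?_
      split_ifs with hi
      · have h1 := ih (N - w i) (by have := hw i; omega)
        have h2 : r ^ N = r ^ (N - w i) * r ^ w i := by rw [← pow_add]; congr 1; omega
        rw [h2, ← mul_assoc]
        exact mul_le_of_le_one_left (by positivity) h1
      · simp only [Nat.cast_zero, zero_mul]; positivity

lemma exists_le_listCount_mul_pow (hw : ∀ i, 1 ≤ w i) {i₀ : ι} (hi₀ : w i₀ = 1) (hr : 0 < r)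
    (hr1 : r < 1) (hsum : ∑ i, r ^ w i = 1) : ∃ c, 0 < c ∧ ∀ N, c ≤ listCount w N * r ^ N := by
  obtain ⟨D, hD⟩ : ∃ D, ∀ i, w i ≤ D :=
    ⟨Finset.univ.sup w, fun i => Finset.le_sup (Finset.mem_univ i)⟩
  refine ⟨r ^ D, by positivity, fun N => ?_⟩
  induction N using Nat.strong_induction_on with
  | _ N ih =>
    rcases le_or_gt N D with hN | hN
    · have h1 : 1 ≤ listCount w N := by
        have : Finite {L : List ι // (L.map w).sum = N} := (finite_list_sum_eq hw N).to_subtype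
        exact Nat.one_le_iff_ne_zero.2 (Nat.card_ne_zero.2
          ⟨⟨List.replicate N i₀, by simp [hi₀]⟩, this⟩)
      calc r ^ D ≤ 1 * r ^ N := by
            rw [one_mul]; exact pow_le_pow_of_le_one hr.le hr1.le hN
        _ ≤ _ := by gcongr; exact_mod_cast h1
    · have hD1 := hD i₀
      rw [listCount_eq_sum hw (by omega), ← mul_one (r ^ D), ← hsum, Nat.cast_sum, Finset.sum_mul,
        Finset.mul_sum]
      refine Finset.sum_le_sum fun i _ => ?_
      have hi := hD i
      rw [if_pos (by omega)]
      have h1 := ih (N - w i) (by have := hw i; omega)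
      have h2 : r ^ N = r ^ (N - w i) * r ^ w i := by rw [← pow_add]; congr 1; omega
      rw [h2, ← mul_assoc]
      gcongr

/-- For every `K`, at most `C r⁻ᴷ` objects have weight at most `K`. -/
def IsExpBounded (r : ℝ) {X : Type} (wt : X → ℕ) : Prop :=
  ∃ C : ℝ, ∀ K, {x | wt x ≤ K}.Finite ∧ {x | wt x ≤ K}.ncard * r ^ K ≤ C

/-- Summing the exponential bound over all smaller exponents only changes the constant. -/
lemma ncard_biUnion_mul_pow_le {X : Type} {A : ℕ → Set X} {C : ℝ} (hr : 0 < r) (hr1 : r < 1)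
    (hC : ∀ j, (A j).ncard * r ^ j ≤ C) (K : ℕ) :
    (⋃ j ∈ Finset.range (K + 1), A j).ncard * r ^ K ≤ C * (1 - r)⁻¹ := by
  have hC0 : 0 ≤ C := le_trans (by positivity) (hC 0)
  calc ((⋃ j ∈ Finset.range (K + 1), A j).ncard : ℝ) * r ^ K
      ≤ (∑ j ∈ Finset.range (K + 1), ((A j).ncard : ℝ)) * r ^ K := by
        gcongr
        exact_mod_cast Finset.set_ncard_biUnion_le _ _
    _ = ∑ j ∈ Finset.range (K + 1), (A j).ncard * r ^ j * r ^ (K - j) := by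
        rw [Finset.sum_mul]
        refine Finset.sum_congr rfl fun j hj => ?_
        rw [mul_assoc, ← pow_add]
        congr 2
        have := Finset.mem_range.1 hj
        omega
    _ ≤ ∑ j ∈ Finset.range (K + 1), C * r ^ (K - j) := by
        gcongr with j
        exact hC j
    _ = C * ∑ j ∈ Finset.range (K + 1), r ^ j := by
        rw [← Finset.mul_sum]
        congr 1
        exact Finset.sum_range_reflect (fun j => r ^ j) (K + 1)
    _ ≤ C * (1 - r)⁻¹ := by
        gcongr
        rw [← tsum_geometric_of_lt_one hr.le hr1]
        exact (summable_geometric_of_lt_one hr.le hr1).sum_le_tsum _ fun _ _ => by positivity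

lemma isExpBounded_list (hw : ∀ i, 1 ≤ w i) (hr : 0 < r) (hr1 : r < 1)
    (hsum : ∑ i, r ^ w i = 1) : IsExpBounded r fun L : List ι => (L.map w).sum := by
  refine ⟨1 * (1 - r)⁻¹, fun K => ⟨finite_list_sum_le hw K, ?_⟩⟩
  convert ncard_biUnion_mul_pow_le (A := fun j => {L : List ι | (L.map w).sum = j}) hr hr1
    (fun j => listCount_mul_pow_le hw hr hsum j) K using 4
  ext L
  simp

lemma IsExpBounded.prod_nat {X : Type} {wt : X → ℕ} (h : IsExpBounded r wt) (hr : 0 < r)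
    (hr1 : r < 1) : IsExpBounded r fun x : X × ℕ => wt x.1 + x.2 := by
  obtain ⟨C, hC⟩ := h
  refine ⟨C * (1 - r)⁻¹, fun K => ?_⟩
  have hset : {x : X × ℕ | wt x.1 + x.2 ≤ K} =
      ⋃ j ∈ Finset.range (K + 1), (fun x => (x, K - j)) '' {x | wt x ≤ j} := by
    ext ⟨x, p⟩
    simp only [Set.mem_ofPred_eq, Set.mem_iUnion, Finset.mem_range, Set.mem_image, Prod.mk.injEq]
    constructor
    · intro hx
      exact ⟨K - p, by omega, x, by omega, rfl, by omega⟩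
    · rintro ⟨j, hj, y, hy, rfl, rfl⟩
      omega
  rw [hset]
  refine ⟨Set.Finite.biUnion (Finset.finite_toSet _) fun j _ => (hC j).1.image _,
    ncard_biUnion_mul_pow_le hr hr1 (fun j => le_trans ?_ (hC j).2) K⟩
  gcongr
  exact Set.ncard_image_le (hC j).1

lemma IsExpBounded.prod_finite {X Y : Type} [Finite Y] {wt : X → ℕ} (h : IsExpBounded r wt) :
    IsExpBounded r fun x : X × Y => wt x.1 := by
  obtain ⟨C, hC⟩ := h
  refine ⟨C * Nat.card Y, fun K => ?_⟩
  have hset : {x : X × Y | wt x.1 ≤ K} = {x | wt x ≤ K} ×ˢ Set.univ := by ext; simp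
  rw [hset]
  refine ⟨(hC K).1.prod Set.finite_univ, ?_⟩
  rw [Set.ncard_prod, Set.ncard_univ, Nat.cast_mul, mul_right_comm]
  gcongr
  exact (hC K).2

end Counting

/-! ### Growth rates and smallest roots -/

lemma hasGrowthRate_of_bounds {f : ℕ → ℕ} {r c C : ℝ} (hr : 0 < r) (hr1 : r < 1) (hc : 0 < c)
    (h1 : ∀ N, 1 ≤ N → c ≤ f N * r ^ N) (h2 : ∀ N, f N * r ^ N ≤ C) : HasGrowthRate f r⁻¹ := by
  have hl : 1 < r⁻¹ := (one_lt_inv₀ hr).2 hr1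
  have hlog : 0 < Real.log r⁻¹ := Real.log_pos hl
  refine ⟨hl, ?_, ?_, ?_⟩
  · have hlim : Tendsto (fun N : ℕ => Real.log (f N * r ^ N) / (N * Real.log r⁻¹) + 1) atTop
        (𝓝 (0 + 1)) := by
      refine Tendsto.add_const 1 (tendsto_bdd_div_atTop_nhds_zero (b := Real.log c)
        (B := Real.log C) ?_ ?_ (tendsto_natCast_atTop_atTop.atTop_mul_const hlog))
      · filter_upwards [eventually_ge_atTop 1] with N hN using Real.log_le_log hc (h1 N hN)
      · filter_upwards [eventually_ge_atTop 1] with N hN using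
          Real.log_le_log (hc.trans_le (h1 N hN)) (h2 N)
    rw [zero_add] at hlim
    refine hlim.congr' ?_
    filter_upwards [eventually_ge_atTop 1] with N hN
    have hpow : 0 < r ^ N := by positivity
    have hf : (f N : ℝ) ≠ 0 := by
      intro h0
      have := h1 N hN
      rw [h0, zero_mul] at this
      exact absurd this (not_le.2 hc)
    have hN0 : (N : ℝ) ≠ 0 := by positivity
    rw [Real.log_mul hf hpow.ne', Real.log_pow, Real.log_inv]
    have hlog0 : Real.log r ≠ 0 := (Real.log_neg hr hr1).ne
    field_simp
    ring
  · refine IsBigO.of_bound C (Eventually.of_forall fun N => ?_)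
    have hpow : 0 < r ^ N := by positivity
    rw [Real.norm_of_nonneg (by positivity), Real.norm_of_nonneg (by positivity), inv_pow,
      ← div_eq_mul_inv, le_div_iff₀ hpow]
    exact h2 N
  · refine IsBigO.of_bound c⁻¹ ?_
    filter_upwards [eventually_ge_atTop 1] with N hN
    have hpow : 0 < r ^ N := by positivity
    rw [Real.norm_of_nonneg (by positivity), Real.norm_of_nonneg (by positivity), inv_pow,
      ← div_eq_inv_mul, le_div_iff₀ hc, inv_mul_le_iff₀ hpow]
    linarith [h1 N hN]

section Roots

variable {ι : Type} [Fintype ι] {w : ι → ℕ}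

lemma exists_sum_pow_eq_one (hw : ∀ i, 1 ≤ w i) (hcard : 1 < Fintype.card ι) :
    ∃ r : ℝ, 0 < r ∧ r < 1 ∧ ∑ i, r ^ w i = 1 := by
  have hcont : ContinuousOn (fun x : ℝ => ∑ i, x ^ w i) (Set.Icc 0 1) := by fun_prop
  have h0 : ∑ i, (0 : ℝ) ^ w i = 0 :=
    Finset.sum_eq_zero fun i _ => zero_pow (by have := hw i; omega)
  have h1 : ∑ i, (1 : ℝ) ^ w i = Fintype.card ι := by simp
  have hc : (1 : ℝ) < Fintype.card ι := by exact_mod_cast hcard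
  obtain ⟨r, ⟨hr0, hr1⟩, hr⟩ := intermediate_value_Ioo zero_le_one hcont
    (show (1 : ℝ) ∈ Set.Ioo _ _ by rw [h0, h1]; exact ⟨one_pos, hc⟩)
  exact ⟨r, hr0, hr1, hr⟩

/-- Since all coefficients are nonnegative and the linear one is positive, the triangle inequality
is strict at any other root of absolute value at most `r`. -/
lemma lt_norm_of_sum_pow_eq_one {i₀ : ι} (hi₀ : w i₀ = 1) {r : ℝ}
    (hsum : ∑ i, r ^ w i = 1) {z : ℂ} (hz : ∑ i, z ^ w i = 1) (hne : z ≠ r) : r < ‖z‖ := by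
  by_contra hle
  push Not at hle
  have hterm : ∀ i, (z ^ w i).re ≤ r ^ w i := fun i =>
    (Complex.re_le_norm _).trans (by rw [norm_pow]; gcongr)
  have hre : z.re = r := by
    refine le_antisymm ((Complex.re_le_norm z).trans hle) (not_lt.1 fun hlt => ?_)
    have h1 : ∑ i, (z ^ w i).re < ∑ i, r ^ w i :=
      Finset.sum_lt_sum (fun i _ => hterm i) ⟨i₀, Finset.mem_univ _, by simpa [hi₀] using hlt⟩
    rw [hsum, ← Complex.re_sum, hz, Complex.one_re] at h1
    exact lt_irrefl _ h1
  apply hne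
  apply Complex.ext
  · simpa using hre
  · have h1 := Complex.sq_norm z
    rw [Complex.normSq_apply, hre] at h1
    have h2 : ‖z‖ ^ 2 ≤ r ^ 2 := by gcongr
    have h3 : z.im * z.im = 0 := le_antisymm (by nlinarith) (mul_self_nonneg _)
    simpa using h3

end Roots

/-- The length of the part of a word spent on the digits `l`: each digit `d` is written `a^d` and
followed by one letter `t`. -/
def digitWeight (l : List ℤ) : ℕ := digitNorm l + l.length

lemma sum_Icc_natAbs {R : Type} [CommRing R] (f : ℕ → R) (m : ℕ) :
    ∑ i ∈ Finset.Icc (-(m : ℤ)) m, f i.natAbs = f 0 + ∑ i ∈ Finset.Icc 1 m, 2 * f i := by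
  induction m with
  | zero => simp
  | succ m ih =>
    have hset : Finset.Icc (-((m + 1 : ℕ) : ℤ)) ((m + 1 : ℕ) : ℤ) =
        insert ((m + 1 : ℕ) : ℤ) (insert (-((m + 1 : ℕ) : ℤ)) (Finset.Icc (-(m : ℤ)) m)) := by
      ext i
      simp only [Finset.mem_Icc, Finset.mem_insert]
      omega
    rw [hset, Finset.sum_insert, Finset.sum_insert, ih, Finset.sum_Icc_succ_top (by omega)]
    · rw [Int.natAbs_neg, Int.natAbs_natCast]
      ring
    · simp only [Finset.mem_Icc]; omega
    · simp only [Finset.mem_Icc, Finset.mem_insert]; omega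

lemma aeval_oddPoly (n : ℕ) (z : ℂ) :
    Polynomial.aeval z (oddPoly (n / 2)) = 1 - ∑ i, z ^ digitWeight (oddBlock n i) := by
  have h := sum_Icc_natAbs (fun j => z ^ (j + 1)) (n / 2)
  have h' : ∑ i, z ^ digitWeight (oddBlock n i) =
      ∑ i ∈ Finset.Icc (-((n / 2 : ℕ) : ℤ)) ((n / 2 : ℕ) : ℤ), z ^ (i.natAbs + 1) := by
    simp only [digitWeight, oddBlock, digitNorm_cons, digitNorm_nil, add_zero,
      List.length_singleton]
    exact Finset.sum_coe_sort _ fun i : ℤ => z ^ (i.natAbs + 1)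
  have h2 : Polynomial.aeval z (2 : ℤ[X]) = 2 := map_ofNat _ 2
  rw [h', h, oddPoly]
  simp [h2]
  ring

lemma aeval_evenPoly {n : ℕ} (hn : 2 ≤ n) (z : ℂ) :
    Polynomial.aeval z (evenPoly (n / 2)) =
      (1 - z) * (1 - ∑ i, z ^ digitWeight (evenBlock n i)) := by
  obtain ⟨m, hm⟩ : ∃ m, n / 2 = m + 1 := ⟨n / 2 - 1, by omega⟩
  have h := sum_Icc_natAbs (fun j => z ^ (j + 1)) m
  have h1 : ∑ i, z ^ digitWeight (evenBlock n (.inl i)) =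
      ∑ i ∈ Finset.Icc (-(m : ℤ)) m, z ^ (i.natAbs + 1) := by
    have hset : Finset.Icc (-(m : ℤ)) m =
        Finset.Ioo (-((n / 2 : ℕ) : ℤ)) ((n / 2 : ℕ) : ℤ) := by
      ext i; simp only [Finset.mem_Icc, Finset.mem_Ioo]; omega
    simp only [hset, digitWeight, evenBlock, digitNorm_cons, digitNorm_nil, add_zero,
      List.length_singleton]
    exact Finset.sum_coe_sort _ fun i : ℤ => z ^ (i.natAbs + 1)
  have h2 : ∑ i, z ^ digitWeight (evenBlock n (.inr i)) =
      2 * z ^ (m + 3) * ∑ e ∈ Finset.range (m + 1), z ^ e := by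
    rw [Fintype.sum_prod_type, Fintype.sum_bool]
    have hs : ∀ s, ∑ e, z ^ digitWeight (evenBlock n (.inr (s, e))) =
        z ^ (m + 3) * ∑ e ∈ Finset.range (m + 1), z ^ e := by
      intro s
      rw [← hm, Finset.sum_range, Finset.mul_sum]
      refine Finset.sum_congr rfl fun e _ => ?_
      rw [← pow_add]
      congr 1
      cases s <;> simp [digitWeight, evenBlock] <;> omega
    rw [hs, hs]
    ring
  have h3 : ∀ m : ℕ, (1 - z) * ∑ i ∈ Finset.Icc 1 m, 2 * z ^ (i + 1) = 2 * z ^ 2 * (1 - z ^ m) := by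
    intro m
    induction m with
    | zero => simp
    | succ m ih => rw [Finset.sum_Icc_succ_top (by omega), mul_add, ih]; ring
  have h4 := mul_neg_geom_sum z (m + 1)
  have h5 : Polynomial.aeval z (2 : ℤ[X]) = 2 := map_ofNat _ 2
  rw [Fintype.sum_sum_type, h1, h2, h, evenPoly, hm]
  simp only [map_add, map_sub, map_mul, map_pow, map_one, Polynomial.aeval_X, h5]
  linear_combination h3 m + 2 * z ^ (m + 3) * h4

/-! ### The affine representation and the word problem -/

/-- The `t`-exponent of a word. -/
def height : Word → ℤ
  | [] => 0
  | (Gen.a, _) :: W => height W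
  | (Gen.t, b) :: W => (if b then 1 else -1) + height W

/-- The image of `0` under a word acting on `ℚ` by the affine maps `a : y ↦ 1 + y` and
`t : y ↦ n y`. -/
def translation (n : ℕ) : Word → ℚ
  | [] => 0
  | (Gen.a, b) :: W => (if b then 1 else -1) + translation n W
  | (Gen.t, true) :: W => n * translation n W
  | (Gen.t, false) :: W => (n : ℚ)⁻¹ * translation n W

lemma height_append (W W' : Word) : height (W ++ W') = height W + height W' := by
  induction W with
  | nil => simp [height]
  | cons s W ih => obtain ⟨_ | _, b⟩ := s <;> simp [height, ih, add_assoc]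

lemma translation_append {n : ℕ} (hn : n ≠ 0) (W W' : Word) :
    translation n (W ++ W') = translation n W + (n : ℚ) ^ height W * translation n W' := by
  have hn' : (n : ℚ) ≠ 0 := by exact_mod_cast hn
  induction W with
  | nil => simp [height, translation]
  | cons s W ih =>
    obtain ⟨_ | _, _ | _⟩ := s <;>
      simp only [List.cons_append, height, translation, ih, if_true, Bool.false_eq_true, if_false]
    · ring
    · ring
    · rw [zpow_add₀ hn', zpow_neg_one]; ring
    · rw [zpow_add₀ hn', zpow_one]; ring

/-- The affine maps by which the generators act on `ℚ`. -/
def genPerm {n : ℕ} (hn : n ≠ 0) : Gen → Equiv.Perm ℚ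
  | Gen.a => Equiv.addLeft 1
  | Gen.t => Equiv.mulLeft₀ (n : ℚ) (Nat.cast_ne_zero.2 hn)

lemma addLeft_one_pow_apply (k : ℕ) (y : ℚ) :
    ((Equiv.addLeft 1 : Equiv.Perm ℚ) ^ k) y = k + y := by
  induction k with
  | zero => simp
  | succ k ih => rw [pow_succ', Equiv.Perm.mul_apply, ih]; simp; ring

lemma lift_genPerm_relator {n : ℕ} (hn : n ≠ 0) :
    ∀ R ∈ ({relator n} : Set (FreeGroup Gen)), FreeGroup.lift (genPerm hn) R = 1 := by
  rintro _ rfl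
  simp only [relator, map_mul, map_inv, map_pow, FreeGroup.lift_apply_of]
  rw [mul_inv_eq_one, mul_inv_eq_iff_eq_mul]
  ext y
  simp only [Equiv.Perm.mul_apply, genPerm, addLeft_one_pow_apply, Equiv.coe_addLeft,
    Equiv.mulLeft₀_apply]
  ring

lemma lift_genPerm_mk {n : ℕ} (hn : n ≠ 0) (W : Word) (y : ℚ) :
    FreeGroup.lift (genPerm hn) (FreeGroup.mk W) y = (n : ℚ) ^ height W * y + translation n W := by
  have hn' : (n : ℚ) ≠ 0 := by exact_mod_cast hn
  rw [FreeGroup.lift_mk]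
  induction W with
  | nil => simp [height, translation]
  | cons s W ih =>
    rw [List.map_cons, List.prod_cons, Equiv.Perm.mul_apply, ih]
    obtain ⟨_ | _, _ | _⟩ := s
    · simp [genPerm, height, translation]; ring
    · simp [genPerm, height, translation]; ring
    · simp [genPerm, height, translation, zpow_add₀ hn', Equiv.Perm.inv_def]; ring
    · simp [genPerm, height, translation, zpow_add₀ hn']; ring

lemma height_translation_eq_of_wordEval_eq {n : ℕ} (hn : 2 ≤ n) {W W' : Word}
    (h : wordEval n W = wordEval n W') :
    height W = height W' ∧ translation n W = translation n W' := by
  have hn0 : n ≠ 0 := by omega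
  have h1 : FreeGroup.lift (genPerm hn0) (FreeGroup.mk W) =
      FreeGroup.lift (genPerm hn0) (FreeGroup.mk W') :=
    congrArg (PresentedGroup.toGroup (lift_genPerm_relator hn0)) h
  have h2 := fun y => lift_genPerm_mk hn0 W y ▸ lift_genPerm_mk hn0 W' y ▸ DFunLike.congr_fun h1 y
  have h3 : translation n W = translation n W' := by simpa using h2 0
  refine ⟨?_, h3⟩
  have h4 := h2 1
  rw [h3, mul_one, mul_one, add_left_inj] at h4
  exact zpow_right_injective₀ (by positivity) (by norm_cast; omega) h4

section NormalForm

variable {G : Type*} [Group G] {A T : G} {n : ℕ}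

lemma pow_mul_zpow_of_conj (h : T * A * T⁻¹ = A ^ n) (k : ℕ) (v : ℤ) :
    T ^ k * A ^ v = A ^ (v * (n : ℤ) ^ k) * T ^ k := by
  induction k with
  | zero => simp
  | succ k ih =>
    have h1 : ∀ m : ℤ, T * A ^ m = A ^ (m * n) * T := by
      intro m
      rw [← mul_inv_eq_iff_eq_mul, ← conj_zpow, h, ← zpow_natCast, ← zpow_mul, mul_comm]
    rw [pow_succ', mul_assoc, ih, ← mul_assoc, h1, mul_assoc]
    congr 2
    ring

/-- The element `t^{-u} a^v t^w` does not change when `(u, v, w)` is replaced by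
`(u + c, v nᶜ, w + c)`. -/
lemma normalForm_shift (h : T * A * T⁻¹ = A ^ n) (u w c : ℕ) (v : ℤ) :
    T⁻¹ ^ (u + c) * A ^ (v * (n : ℤ) ^ c) * T ^ (w + c) = T⁻¹ ^ u * A ^ v * T ^ w := by
  have h1 := pow_mul_zpow_of_conj h c v
  rw [pow_add, add_comm w c, pow_add, mul_assoc _ _ (A ^ _), mul_assoc, mul_assoc _ (A ^ _),
    ← mul_assoc (A ^ _) (T ^ c), ← h1]
  simp only [inv_pow]
  group

end NormalForm

/-- The image of a generator in `BS(1,n)`. -/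
def genBS (n : ℕ) (s : Gen) : BS n := PresentedGroup.of s

lemma genBS_conj (n : ℕ) :
    genBS n Gen.t * genBS n Gen.a * (genBS n Gen.t)⁻¹ = genBS n Gen.a ^ n := by
  have h : PresentedGroup.mk ({relator n} : Set (FreeGroup Gen)) (relator n) = 1 :=
    PresentedGroup.one_of_mem (Set.mem_singleton _)
  rw [relator, map_mul, map_mul, map_mul, map_inv, map_inv, map_pow, mul_inv_eq_one] at h
  exact h

lemma wordEval_cons_true (n : ℕ) (s : Gen) (W : Word) :
    wordEval n ((s, true) :: W) = genBS n s * wordEval n W := rfl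

lemma wordEval_cons_false (n : ℕ) (s : Gen) (W : Word) :
    wordEval n ((s, false) :: W) = (genBS n s)⁻¹ * wordEval n W := rfl

/-- Every word can be brought to the form `t^{-u} a^v t^w`. -/
lemma exists_normalForm {n : ℕ} (hn : n ≠ 0) (W : Word) : ∃ (u w : ℕ) (v : ℤ),
    wordEval n W = (genBS n Gen.t)⁻¹ ^ u * genBS n Gen.a ^ v * genBS n Gen.t ^ w ∧
    height W = w - u ∧ translation n W * (n : ℚ) ^ u = v := by
  have hn' : (n : ℚ) ≠ 0 := by exact_mod_cast hn
  have hconj := genBS_conj n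
  have hmove : ∀ (u : ℕ) (e : ℤ), genBS n Gen.a ^ e * (genBS n Gen.t)⁻¹ ^ u =
      (genBS n Gen.t)⁻¹ ^ u * genBS n Gen.a ^ (e * (n : ℤ) ^ u) := by
    intro u e
    have := pow_mul_zpow_of_conj hconj u e
    rw [inv_pow, mul_inv_eq_iff_eq_mul, mul_assoc, ← this, inv_mul_cancel_left]
  induction W with
  | nil => exact ⟨0, 0, 0, by simp; rfl, by simp [height], by simp [translation]⟩
  | cons s W ih =>
    obtain ⟨u, w, v, h1, h2, h3⟩ := ih
    obtain ⟨_ | _, _ | _⟩ := s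
    · refine ⟨u, w, -1 * (n : ℤ) ^ u + v, ?_, by simpa [height] using h2, ?_⟩
      · rw [wordEval_cons_false, h1, ← zpow_neg_one, ← mul_assoc, ← mul_assoc, hmove, zpow_add,
          mul_assoc ((genBS n Gen.t)⁻¹ ^ u)]
      · simp [translation, ← h3, add_mul]
    · refine ⟨u, w, 1 * (n : ℤ) ^ u + v, ?_, by simpa [height] using h2, ?_⟩
      · have hone := hmove u 1
        rw [zpow_one] at hone
        rw [wordEval_cons_true, h1, ← mul_assoc, ← mul_assoc, hone, zpow_add,
          mul_assoc ((genBS n Gen.t)⁻¹ ^ u)]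
      · simp [translation, ← h3, add_mul]
    · refine ⟨u + 1, w, v, ?_, by simp [height, h2]; ring, ?_⟩
      · rw [wordEval_cons_false, h1, pow_succ']
        simp only [mul_assoc]
      · rw [← h3, translation, pow_succ]
        field_simp
    · rcases u with _ | u
      · refine ⟨0, w + 1, v * n, ?_, by simp [height, h2]; ring, ?_⟩
        · have := pow_mul_zpow_of_conj hconj 1 v
          simp only [pow_one] at this
          rw [wordEval_cons_true, h1, pow_zero, one_mul, one_mul, ← mul_assoc, this, mul_assoc,
            ← pow_succ']
        · push_cast
          rw [← h3, translation]
          ring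
      · refine ⟨u, w, v, ?_, by simp [height, h2]; ring, ?_⟩
        · rw [wordEval_cons_true, h1, pow_succ']
          simp only [mul_assoc, mul_inv_cancel_left]
        · rw [← h3, translation, pow_succ]
          ring

/-- Two words represent the same element of `BS(1,n)` iff they act on `ℚ` by the same map. -/
lemma wordEval_eq_iff {n : ℕ} (hn : 2 ≤ n) {W W' : Word} :
    wordEval n W = wordEval n W' ↔
      height W = height W' ∧ translation n W = translation n W' := by
  refine ⟨height_translation_eq_of_wordEval_eq hn, fun ⟨hh, ht⟩ => ?_⟩
  have hn0 : n ≠ 0 := by omega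
  have hn' : (n : ℚ) ≠ 0 := by exact_mod_cast hn0
  obtain ⟨u, w, v, h1, h2, h3⟩ := exists_normalForm hn0 W
  obtain ⟨u', w', v', h1', h2', h3'⟩ := exists_normalForm hn0 W'
  have hconj := genBS_conj n
  rw [h1, h1']
  rcases le_total u u' with hu | hu
  · obtain ⟨c, rfl⟩ := Nat.exists_eq_add_of_le hu
    obtain rfl : w' = w + c := by omega
    have hv : v' = v * (n : ℤ) ^ c := by
      have : (v' : ℚ) = v * (n : ℚ) ^ c := by rw [← h3', ← h3, ← ht, pow_add]; ring
      exact_mod_cast this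
    rw [hv, normalForm_shift hconj]
  · obtain ⟨c, rfl⟩ := Nat.exists_eq_add_of_le hu
    obtain rfl : w = w' + c := by omega
    have hv : v = v' * (n : ℤ) ^ c := by
      have : (v : ℚ) = v' * (n : ℚ) ^ c := by rw [← h3', ← h3, ← ht, pow_add]; ring
      exact_mod_cast this
    rw [hv, normalForm_shift hconj]

lemma exists_wordEval_eq (n : ℕ) (g : BS n) : ∃ W, wordEval n W = g := by
  obtain ⟨x, rfl⟩ := PresentedGroup.mk_surjective _ g
  obtain ⟨W, rfl⟩ := Quot.exists_rep x
  exact ⟨W, rfl⟩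

lemma wordLength_le (n : ℕ) (W : Word) : wordLength n (wordEval n W) ≤ W.length :=
  Nat.sInf_le ⟨W, rfl, rfl⟩

lemma exists_length_eq_wordLength (n : ℕ) (g : BS n) :
    ∃ W, wordEval n W = g ∧ W.length = wordLength n g := by
  obtain ⟨W, hW⟩ := exists_wordEval_eq n g
  exact Nat.sInf_mem (s := {m : ℕ | ∃ W : Word, wordEval n W = g ∧ W.length = m}) ⟨_, W, hW, rfl⟩

/-! ### The digits of a word -/

lemma digitValue_modify (n : ℕ) (e : ℤ) : ∀ (D : List ℤ) (p : ℕ), p < D.length →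
    digitValue n (D.modify p (e + ·)) = e * (n : ℤ) ^ p + digitValue n D
  | [], p, h => by simp at h
  | d :: D, 0, _ => by simp; ring
  | d :: D, p + 1, h => by
    simp only [List.modify_succ_cons, digitValue_cons]
    rw [digitValue_modify n e D p (by simpa using h)]
    ring

lemma digitNorm_modify_le (e : ℤ) : ∀ (D : List ℤ) (p : ℕ),
    digitNorm (D.modify p (e + ·)) ≤ e.natAbs + digitNorm D
  | [], p => by simp
  | d :: D, 0 => by simp; omega
  | d :: D, p + 1 => by
    have := digitNorm_modify_le e D p
    simp only [List.modify_succ_cons, digitNorm_cons]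
    omega

/-- A word walks along a line of levels, moving by its letters `t^{±1}` and adding `±1` to the
digit at the current level by its letters `a^{±1}`. If `D` lists the digits at all levels visited,
the walk starts at position `p` of `D` and ends at position `p + height W`, and it has to cover an
interval of `D.length` levels, which takes at least `2 (D.length - 1) - |height W|` steps. -/
lemma exists_digits {n : ℕ} (hn : n ≠ 0) (W : Word) : ∃ (p : ℕ) (D : List ℤ),
    p < D.length ∧ 0 ≤ p + height W ∧ p + height W < D.length ∧
    translation n W * (n : ℚ) ^ p = digitValue n D ∧
    2 * D.length + digitNorm D ≤ W.length + (height W).natAbs + 2 := by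
  have hn' : (n : ℚ) ≠ 0 := by exact_mod_cast hn
  induction W with
  | nil => exact ⟨0, [0], by simp, by simp [height], by simp [height], by simp [translation],
      by simp⟩
  | cons s W ih =>
    obtain ⟨p, D, h1, h2, h3, h4, h5⟩ := ih
    have ha : ∀ (e : ℤ) (b : Bool), e.natAbs ≤ 1 →
        translation n ((Gen.a, b) :: W) = e + translation n W →
        ∃ (p : ℕ) (D : List ℤ), p < D.length ∧ 0 ≤ p + height ((Gen.a, b) :: W) ∧
          p + height ((Gen.a, b) :: W) < D.length ∧
          translation n ((Gen.a, b) :: W) * (n : ℚ) ^ p = digitValue n D ∧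
          2 * D.length + digitNorm D ≤
            ((Gen.a, b) :: W).length + (height ((Gen.a, b) :: W)).natAbs + 2 := by
      intro e b he ht
      refine ⟨p, D.modify p (e + ·), by simpa using h1, h2, by simpa [height] using h3, ?_, ?_⟩
      · rw [ht, digitValue_modify n e D p h1, add_mul, h4]
        push_cast
        rfl
      · have := digitNorm_modify_le e D p
        simp only [List.length_modify, List.length_cons, height]
        omega
    obtain ⟨_ | _, _ | _⟩ := s
    · exact ha (-1) false (by simp) (by simp [translation])
    · exact ha 1 true (by simp) (by simp [translation])
    · have ht : translation n ((Gen.t, false) :: W) * (n : ℚ) ^ (p + 1) = digitValue n D := by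
        rw [← h4, translation, pow_succ]
        field_simp
      have hh : height ((Gen.t, false) :: W) = -1 + height W := rfl
      rcases lt_or_ge (p + 1) D.length with hp | hp
      · refine ⟨p + 1, D, hp, ?_, ?_, ht, ?_⟩ <;> rw [hh] <;> (try rw [List.length_cons]) <;> omega
      · refine ⟨p + 1, D ++ [0], ?_, ?_, ?_, by rw [ht]; simp [digitValue_append], ?_⟩ <;>
          simp only [hh, List.length_append, List.length_cons, List.length_nil, digitNorm_append,
            digitNorm_cons, digitNorm_nil] <;> omega
    · have hh : height ((Gen.t, true) :: W) = 1 + height W := rfl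
      rcases p with _ | p
      · refine ⟨0, 0 :: D, ?_, ?_, ?_, ?_, ?_⟩
        · simp
        · rw [hh]; omega
        · rw [hh, List.length_cons]; omega
        · have h4' : translation n W = digitValue n D := by simpa using h4
          rw [translation, h4']
          simp
        · simp only [hh, List.length_cons, digitNorm_cons]; omega
      · have ht : translation n ((Gen.t, true) :: W) * (n : ℚ) ^ p = digitValue n D := by
          rw [← h4, translation, pow_succ]
          ring
        refine ⟨p, D, by omega, ?_, ?_, ht, ?_⟩ <;> rw [hh] <;>
          (try rw [List.length_cons]) <;> omega

/-! ### The words `η` -/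

@[simp] lemma length_powWord (s : Gen) (m : ℤ) : (powWord s m).length = m.natAbs := by
  simp [powWord]

lemma height_replicate_t (b : Bool) (k : ℕ) :
    height (List.replicate k (Gen.t, b)) = (if b then 1 else -1) * k := by
  induction k with
  | zero => simp [height]
  | succ k ih => rw [List.replicate_succ, height, ih]; push_cast; ring

@[simp] lemma height_powWord_t (m : ℤ) : height (powWord Gen.t m) = m := by
  rw [powWord, height_replicate_t]
  by_cases h : 0 ≤ m <;> simp only [h, decide_true, decide_false, if_true, if_false,
    Bool.false_eq_true] <;> omega

@[simp] lemma translation_powWord_t (n : ℕ) (m : ℤ) : translation n (powWord Gen.t m) = 0 := by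
  rw [powWord]
  generalize decide (0 ≤ m) = b
  induction m.natAbs with
  | zero => rfl
  | succ k ih =>
    rw [List.replicate_succ]
    cases b <;> rw [translation, ih, mul_zero]

@[simp] lemma height_powWord_a (m : ℤ) : height (powWord Gen.a m) = 0 := by
  rw [powWord]
  induction m.natAbs with
  | zero => rfl
  | succ k ih => rw [List.replicate_succ, height, ih]

@[simp] lemma translation_powWord_a (n : ℕ) (m : ℤ) : translation n (powWord Gen.a m) = m := by
  have h : ∀ (b : Bool) (k : ℕ),
      translation n (List.replicate k (Gen.a, b)) = (if b then 1 else -1) * k := by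
    intro b k
    induction k with
    | zero => simp [translation]
    | succ k ih => rw [List.replicate_succ, translation, ih]; push_cast; ring
  rw [powWord, h, Nat.cast_natAbs]
  by_cases hm : 0 ≤ m
  · simp [hm, abs_of_nonneg hm]
  · simp [hm, abs_of_neg (not_le.1 hm)]

lemma length_upWord (x : ℕ →₀ ℤ) (k : ℕ) :
    (upWord x k).length = k + ∑ i ∈ Finset.range (k + 1), (x i).natAbs := by
  induction k with
  | zero => simp [upWord]
  | succ k ih =>
    rw [upWord, List.length_append, List.length_cons, ih, length_powWord,
      Finset.sum_range_succ _ (k + 1)]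
    ring

lemma height_upWord (x : ℕ →₀ ℤ) (k : ℕ) : height (upWord x k) = k := by
  induction k with
  | zero => simp [upWord]
  | succ k ih => simp [upWord, height_append, height, ih]

lemma translation_upWord {n : ℕ} (hn : n ≠ 0) (x : ℕ →₀ ℤ) (k : ℕ) :
    translation n (upWord x k) = ∑ i ∈ Finset.range (k + 1), (x i : ℚ) * (n : ℚ) ^ i := by
  induction k with
  | zero => simp [upWord]
  | succ k ih =>
    rw [upWord, translation_append hn, ih, height_upWord, Finset.sum_range_succ _ (k + 1),
      translation, translation_powWord_a, zpow_natCast]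
    ring

lemma eta_of_lastIndex_le {u w : ℕ} {x : ℕ →₀ ℤ} (h : lastIndex x ≤ w) :
    eta u w x = powWord Gen.t (-(u : ℤ)) ++ upWord x (lastIndex x) ++
      powWord Gen.t ((w : ℤ) - (lastIndex x : ℤ)) := if_pos h

/-- With `u = 0` only the shapes 1 and 3 occur, which are given by the same formula. -/
lemma eta_zero (w : ℕ) (x : ℕ →₀ ℤ) :
    eta 0 w x = powWord Gen.t (-((0 : ℕ) : ℤ)) ++ upWord x (lastIndex x) ++
      powWord Gen.t ((w : ℤ) - (lastIndex x : ℤ)) := by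
  unfold eta
  split_ifs <;> first | rfl | omega

lemma apply_eq_zero_of_lastIndex_lt {x : ℕ →₀ ℤ} {i : ℕ} (h : lastIndex x < i) : x i = 0 := by
  by_contra hx
  exact absurd (Finset.le_sup (f := id) (Finsupp.mem_support_iff.2 hx)) (not_le.2 h)

lemma sum_range_of_lastIndex_lt {M : Type} [AddCommMonoid M] {x : ℕ →₀ ℤ} {K : ℕ}
    (h : lastIndex x < K) {f : ℕ → ℤ → M} (hf : ∀ i, f i 0 = 0) :
    ∑ i ∈ Finset.range K, f i (x i) = x.sum f := by
  refine (Finsupp.sum_of_support_subset x (fun i hi => ?_) f fun i _ => hf i).symm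
  rw [Finset.mem_range]
  exact lt_of_le_of_lt (Finset.le_sup (f := id) hi) h

/-- The word `t^{-u} a^{x_0} t ⋯ t a^{x_k} t^{w-k}` represents `t^{-u} a^v t^w`. -/
lemma height_translation_up {n : ℕ} (hn : n ≠ 0) (u w : ℕ) {v : ℤ} {x : ℕ →₀ ℤ}
    (hx : x ∈ digitLattice n v) {W : Word}
    (hW : W = powWord Gen.t (-(u : ℤ)) ++ upWord x (lastIndex x) ++
      powWord Gen.t ((w : ℤ) - (lastIndex x : ℤ))) :
    height W = w - u ∧ translation n W * (n : ℚ) ^ u = v := by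
  have hn' : (n : ℚ) ≠ 0 := by exact_mod_cast hn
  have hv : ∑ i ∈ Finset.range (lastIndex x + 1), x i * (n : ℤ) ^ i = v := by
    rw [sum_range_of_lastIndex_lt (Nat.lt_succ_self _) (f := fun i d => d * (n : ℤ) ^ i)
      (by simp)]
    exact hx
  subst hW
  constructor
  · simp [height_append, height_upWord]
    ring
  · rw [translation_append hn, translation_append hn, translation_upWord hn, ← hv]
    simp only [translation_powWord_t, height_powWord_t, zero_add, mul_zero, add_zero, zpow_neg,
      zpow_natCast]
    push_cast
    field_simp

lemma length_eta_of_lastIndex_le {u w : ℕ} {x : ℕ →₀ ℤ} (h : lastIndex x ≤ w) :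
    (eta u w x).length = u + w + x.sum fun _ d => d.natAbs := by
  rw [eta_of_lastIndex_le h, List.length_append, List.length_append, length_upWord,
    sum_range_of_lastIndex_lt (Nat.lt_succ_self _) (f := fun _ d => d.natAbs) (by simp)]
  simp only [length_powWord]
  omega

/-! ### Geodesics spelled by blocks -/

lemma digitValue_eq_sum (n : ℕ) (l : List ℤ) : ∀ K, l.length ≤ K →
    ∑ i ∈ Finset.range K, l.getD i 0 * (n : ℤ) ^ i = digitValue n l := by
  induction l with
  | nil => intro K _; simp
  | cons d l ih =>
    intro K hK
    obtain ⟨K, rfl⟩ : ∃ K', K = K' + 1 := ⟨K - 1, by simp at hK; omega⟩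
    rw [Finset.sum_range_succ', digitValue_cons, ← ih K (by simpa using hK), Finset.mul_sum]
    simp only [List.getD_cons_succ, List.getD_cons_zero, pow_zero, mul_one]
    rw [add_comm]
    congr 1
    exact Finset.sum_congr rfl fun i _ => by ring

lemma digitNorm_eq_sum (l : List ℤ) : ∀ K, l.length ≤ K →
    ∑ i ∈ Finset.range K, (l.getD i 0).natAbs = digitNorm l := by
  induction l with
  | nil => intro K _; simp
  | cons d l ih =>
    intro K hK
    obtain ⟨K, rfl⟩ : ∃ K', K = K' + 1 := ⟨K - 1, by simp at hK; omega⟩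
    rw [Finset.sum_range_succ', digitNorm_cons, ← ih K (by simpa using hK)]
    simp only [List.getD_cons_succ, List.getD_cons_zero]
    rw [add_comm]

/-- The finitely supported vector with the digits of a list. -/
def digitVector (l : List ℤ) : ℕ →₀ ℤ := l.toFinsupp

@[simp] lemma digitVector_apply (l : List ℤ) (i : ℕ) : digitVector l i = l.getD i 0 := rfl

lemma lastIndex_digitVector_lt {l : List ℤ} (hl : l ≠ []) :
    lastIndex (digitVector l) < l.length := by
  refine (Finset.sup_lt_iff (List.length_pos_of_ne_nil hl)).2 fun i hi => ?_
  by_contra hlt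
  exact Finsupp.mem_support_iff.1 hi (List.getD_eq_default l 0 (not_lt.1 hlt))

lemma digitVector_mem_digitLattice (n : ℕ) {l : List ℤ} (hl : l ≠ []) :
    digitVector l ∈ digitLattice n (digitValue n l) := by
  rw [digitLattice, Set.mem_ofPred_eq, ← sum_range_of_lastIndex_lt (lastIndex_digitVector_lt hl)
    (f := fun i d => d * (n : ℤ) ^ i) (by simp)]
  exact digitValue_eq_sum n l _ le_rfl

/-- The word `a^{x_0} t a^{x_1} t ⋯ a^{x_{w-1}} t` for the digits `x_0, …, x_{w-1}` of a list. -/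
def digitWord (l : List ℤ) : Word := eta 0 l.length (digitVector l)

lemma length_digitWord {l : List ℤ} (hl : l ≠ []) : (digitWord l).length = digitWeight l := by
  rw [digitWord, length_eta_of_lastIndex_le (lastIndex_digitVector_lt hl).le,
    ← sum_range_of_lastIndex_lt (lastIndex_digitVector_lt hl) (f := fun _ d => d.natAbs) (by simp),
    digitWeight, ← digitNorm_eq_sum l _ le_rfl]
  simp only [digitVector_apply]
  ring

/-- A vector in `L_v` is a digit list of any sufficiently large length. -/
lemma exists_list_of_mem_digitLattice {n : ℕ} {v : ℤ} {y : ℕ →₀ ℤ} (hy : y ∈ digitLattice n v)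
    (K : ℕ) : ∃ d : List ℤ, K ≤ d.length ∧ (∀ i, d.getD i 0 = y i) ∧ digitValue n d = v := by
  have hget : ∀ i, (List.map y (List.range (K + lastIndex y + 1))).getD i 0 = y i := by
    intro i
    rcases lt_or_ge i (K + lastIndex y + 1) with hi | hi
    · rw [List.getD_eq_getElem _ _ (by simpa using hi)]
      simp
    · rw [List.getD_eq_default _ _ (by simpa using hi),
        apply_eq_zero_of_lastIndex_lt (by omega)]
  refine ⟨(List.range (K + lastIndex y + 1)).map y, by simp; omega, hget, ?_⟩
  rw [← digitValue_eq_sum n _ (K + lastIndex y + 1) (by simp)]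
  simp only [hget]
  rw [sum_range_of_lastIndex_lt (by omega) (f := fun i d => d * (n : ℤ) ^ i) (by simp)]
  exact hy

lemma listAbsLexLT_of_absLexLT {x y : ℕ →₀ ℤ} {l m : List ℤ} (hl : ∀ i, l.getD i 0 = x i)
    (hm : ∀ i, m.getD i 0 = y i) (h : AbsLexLT x y) : ListAbsLexLT l m := by
  obtain ⟨i, hi, hi'⟩ := h
  simp only [Int.abs_eq_natAbs] at hi hi'
  refine ⟨i, fun j hj => ?_, ?_⟩
  · rw [hl, hm]
    exact_mod_cast hi j hj
  · rw [hl, hm]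
    exact_mod_cast hi'

lemma digitWeight_spell {ι : Type} {blk : ι → List ℤ} (L : List ι) :
    digitWeight (spell blk L) = (L.map fun i => digitWeight (blk i)).sum := by
  induction L with
  | nil => rfl
  | cons i L ih =>
    rw [List.map_cons, List.sum_cons, ← ih, spell_cons]
    simp only [digitWeight, digitNorm_append, List.length_append]
    ring

lemma height_digitWord {n : ℕ} (hn : n ≠ 0) {l : List ℤ} (hl : l ≠ []) :
    height (digitWord l) = l.length ∧ translation n (digitWord l) = digitValue n l := by
  simpa [digitWord] using height_translation_up hn 0 l.length (digitVector_mem_digitLattice n hl)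
    (eta_zero _ _)

section Code

variable {n : ℕ} {ι : Type} [Fintype ι] {blk : ι → List ℤ}

namespace IsDigitCode

lemma natAbs_spell_le (hP : IsDigitCode n blk) (L : List ι) (i : ℕ) :
    ((spell blk L).getD i 0).natAbs ≤ n / 2 := by
  rcases lt_or_ge i (spell blk L).length with hi | hi
  · rw [List.getD_eq_getElem _ _ hi]
    have hmem := List.getElem_mem hi
    generalize (spell blk L)[i] = d at hmem
    simp only [spell, List.mem_flatten, List.mem_map] at hmem
    obtain ⟨_, ⟨j, _, rfl⟩, hd⟩ := hmem
    exact hP.natAbs_le j d hd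
  · rw [List.getD_eq_default _ _ hi]
    simp

/-- A block expansion cannot be beaten by any word: after multiplication by a power of `n` its
digits are still a block expansion, which is compared with the digits of the word. -/
lemma digitWeight_spell_le_length (hP : IsDigitCode n blk) (hn : n ≠ 0) (L : List ι) {W : Word}
    (hh : height W = (spell blk L).length) (ht : translation n W = digitValue n (spell blk L)) :
    digitWeight (spell blk L) ≤ W.length := by
  obtain ⟨p, D, _, _, h3, h4, h5⟩ := exists_digits hn W
  obtain ⟨i₀, hi₀⟩ := hP.zero
  have hs : spell blk (List.replicate p i₀ ++ L) = List.replicate p 0 ++ spell blk L := by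
    rw [spell_append, spell_replicate_zero blk hi₀]
  have hval0 : ∀ k, digitValue n (List.replicate k 0) = 0 := by
    intro k
    induction k with
    | zero => rfl
    | succ k ih => simp [List.replicate_succ, ih]
  have hnorm0 : ∀ k, digitNorm (List.replicate k 0) = 0 := by simp [digitNorm]
  have hD : digitValue n D = (n : ℤ) ^ p * digitValue n (spell blk L) := by
    rw [ht] at h4
    have : (digitValue n D : ℚ) = (n : ℚ) ^ p * digitValue n (spell blk L) := by
      rw [← h4, mul_comm]
    exact_mod_cast this
  have h6 := hP.digitNorm_spell_le (List.replicate p i₀ ++ L) D 0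
    (by rw [hs, List.length_append, List.length_replicate]; omega)
    (by rw [hs, digitValue_append, hval0, hD]; simp)
  rw [hs, digitNorm_append, hnorm0] at h6
  simp only [Int.natAbs_zero] at h6
  rw [digitWeight]
  omega

lemma spell_ne_nil (hP : IsDigitCode n blk) {L : List ι} (hL : L ≠ []) : spell blk L ≠ [] := by
  cases L with
  | nil => exact absurd rfl hL
  | cons i L => simp [hP.ne_nil i]

lemma wordLength_digitWord (hP : IsDigitCode n blk) (hn : 2 ≤ n) {L : List ι} (hL : L ≠ []) :
    wordLength n (wordEval n (digitWord (spell blk L))) = digitWeight (spell blk L) := by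
  have hx := hP.spell_ne_nil hL
  refine le_antisymm (length_digitWord hx ▸ wordLength_le n _) ?_
  obtain ⟨W, hW, hlen⟩ := exists_length_eq_wordLength n (wordEval n (digitWord (spell blk L)))
  rw [← hlen]
  obtain ⟨hh, ht⟩ := (wordEval_eq_iff hn).1 hW
  obtain ⟨hh', ht'⟩ := height_digitWord (n := n) (by omega) hx
  exact hP.digitWeight_spell_le_length (by omega) L (hh.trans hh') (ht.trans ht')

lemma digitWord_mem_strictShapeOneGeodesics (hP : IsDigitCode n blk) (hn : 2 ≤ n) {L : List ι}
    (hL : L ≠ []) : digitWord (spell blk L) ∈ strictShapeOneGeodesics n := by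
  have hx := hP.spell_ne_nil hL
  have hn0 : n ≠ 0 := by omega
  have hlast := lastIndex_digitVector_lt hx
  have hbound : ∀ i, |digitVector (spell blk L) i| ≤ ((n / 2 : ℕ) : ℤ) := fun i => by
    rw [Int.abs_eq_natAbs]
    exact_mod_cast hP.natAbs_spell_le L i
  have hmem := digitVector_mem_digitLattice n hx
  refine ⟨0, digitValue n (spell blk L), (spell blk L).length, digitVector (spell blk L),
    fun _ => Nat.zero_mul _, ⟨hmem, fun i _ => hbound i, fun _ => hbound _, fun h => ?_⟩,
    ⟨hmem, fun y hy => ?_, fun _ y hy _ hlex => ?_⟩, hlast, rfl, ?_⟩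
  · exact absurd ((le_max_right _ _).trans h) (not_le.2 hlast)
  · obtain ⟨hh, ht⟩ := height_translation_up hn0 0 (spell blk L).length hy (eta_zero _ _)
    rw [← digitWord, length_digitWord hx]
    exact hP.digitWeight_spell_le_length hn0 L (by simpa using hh) (by simpa using ht)
  · obtain ⟨d, hd, hget, hv⟩ := exists_list_of_mem_digitLattice hy (spell blk L).length
    have h1 : ListAbsLexLT d (spell blk L) := listAbsLexLT_of_absLexLT hget (fun _ => rfl) hlex
    rcases hP.eq_or_listAbsLexLT hn0 L d hd hv with heq | h2
    · obtain ⟨i, _, hi⟩ := h1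
      rw [heq] at hi
      exact lt_irrefl _ hi
    · exact not_listAbsLexLT_symm h1 h2
  · rw [IsGeodesic, hP.wordLength_digitWord hn hL, length_digitWord hx]

lemma wordEval_digitWord_injective (hP : IsDigitCode n blk) (hn : 2 ≤ n) {L L' : List ι}
    (hL : L ≠ []) (hL' : L' ≠ [])
    (h : wordEval n (digitWord (spell blk L)) = wordEval n (digitWord (spell blk L'))) :
    L = L' := by
  have hn0 : n ≠ 0 := by omega
  obtain ⟨hh, ht⟩ := (wordEval_eq_iff hn).1 h
  obtain ⟨h1, h2⟩ := height_digitWord hn0 (hP.spell_ne_nil hL)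
  obtain ⟨h1', h2'⟩ := height_digitWord hn0 (hP.spell_ne_nil hL')
  rw [h1, h1'] at hh
  rw [h2, h2'] at ht
  have hlen : (spell blk L).length = (spell blk L').length := by exact_mod_cast hh
  have hval : digitValue n (spell blk L) = digitValue n (spell blk L') := by exact_mod_cast ht
  refine hP.spell_injective ?_
  have heq : ∀ i, (spell blk L).getD i 0 = (spell blk L').getD i 0 := by
    rcases hP.eq_or_listAbsLexLT hn0 L _ hlen.le hval.symm with h3 | h3
    · exact h3
    · rcases hP.eq_or_listAbsLexLT hn0 L' _ hlen.ge hval with h4 | h4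
      · exact fun i => (h4 i).symm
      · exact absurd h4 (not_listAbsLexLT_symm h3)
  refine List.ext_getElem hlen fun i hi hi' => ?_
  have := heq i
  rwa [List.getD_eq_getElem _ _ hi, List.getD_eq_getElem _ _ hi'] at this

end IsDigitCode

/-! ### The upper bound for the spheres -/

/-- The data `((((L, k), a), b), (δ, σ, β))` determining an element: a list `L` of blocks, the
absolute value `k` of the digit on top of them, the numbers `a` and `b` of levels covered below and
above the two ends of the walk, and three Booleans: whether the blocks have one more digit than
there are levels covered, the sign of the top digit, and the direction of the walk. -/
abbrev SphereCode (ι : Type) : Type := (((List ι × ℕ) × ℕ) × ℕ) × (Bool × Bool × Bool)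

/-- The height and the translation of a word are determined by data of weight at most `|W| + 2`: the
digits of the word are replaced by their normalization, which can only lower their cost and uses at
most one more level. -/
lemma IsDigitCode.exists_sphereCode (hP : IsDigitCode n blk) (hn : n ≠ 0) :
    ∃ F : SphereCode ι → ℤ × ℚ, ∀ W : Word, ∃ s : SphereCode ι,
      F s = (height W, translation n W) ∧
      digitWeight (spell blk s.1.1.1.1) + s.1.1.1.2 + s.1.1.2 + s.1.2 ≤ W.length + 2 := by
  have hn' : (n : ℚ) ≠ 0 := by exact_mod_cast hn
  -- `len` is the number of levels covered, `c` the top digit, `p` the starting position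
  refine ⟨fun s => match s with
    | ((((L, k), a), b), (δ, σ, β)) =>
      let len : ℤ := ((spell blk L).length : ℤ) - (if δ then 1 else 0)
      let c : ℤ := if σ then k else -k
      let p : ℤ := if β then a else len - 1 - b
      ((if β then len - 1 - b - a else -(len - 1 - b - a)),
        ((digitValue n (spell blk L) + (n : ℤ) ^ (spell blk L).length * c : ℤ) : ℚ) *
          ((n : ℚ) ^ p)⁻¹), fun W => ?_⟩
  obtain ⟨p, D, h1, h2, h3, h4, h5⟩ := exists_digits hn W
  obtain ⟨L, c, g1, g2, g3⟩ := hP.exists_spell D 0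
  rw [zero_add] at g1
  simp only [Int.natAbs_zero, zero_add] at g2
  have htr : ∀ q : ℤ, q = p → ∀ c' : ℤ, c' = c →
      ((digitValue n (spell blk L) + (n : ℤ) ^ (spell blk L).length * c' : ℤ) : ℚ) *
        ((n : ℚ) ^ q)⁻¹ = translation n W := by
    rintro _ rfl _ rfl
    rw [← g1, ← h4, zpow_natCast]
    field_simp
  have hlen : ((spell blk L).length : ℤ) -
      (if decide ((spell blk L).length = D.length + 1) then 1 else 0) = D.length := by
    rcases g3 with h | h <;> simp [h]
  have hc : (if decide (0 ≤ c) then (c.natAbs : ℤ) else -(c.natAbs : ℤ)) = c := by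
    by_cases h : 0 ≤ c <;> simp only [h, decide_true, decide_false, if_true, if_false,
      Bool.false_eq_true] <;> omega
  rcases le_or_gt 0 (height W) with hW | hW
  · refine ⟨((((L, c.natAbs), p), (D.length - 1 - (p + height W)).toNat),
      (decide ((spell blk L).length = D.length + 1), decide (0 ≤ c), true)), ?_, ?_⟩
    · simp only [hlen, if_true, Prod.mk.injEq]
      exact ⟨by omega, htr _ rfl _ hc⟩
    · simp only [digitWeight]
      omega
  · refine ⟨((((L, c.natAbs), (p + height W).toNat), D.length - 1 - p),
      (decide ((spell blk L).length = D.length + 1), decide (0 ≤ c), false)), ?_, ?_⟩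
    · simp only [hlen, if_false, Bool.false_eq_true, Prod.mk.injEq]
      exact ⟨by omega, htr _ (by omega) _ hc⟩
    · simp only [digitWeight]
      omega

lemma IsDigitCode.digitWeight_pos (hP : IsDigitCode n blk) (i : ι) : 1 ≤ digitWeight (blk i) := by
  have := List.length_pos_of_ne_nil (hP.ne_nil i)
  rw [digitWeight]
  omega

lemma IsDigitCode.sphere_bound (hP : IsDigitCode n blk) (hn : 2 ≤ n) {r : ℝ} (hr : 0 < r)
    (hr1 : r < 1) (hsum : ∑ i, r ^ digitWeight (blk i) = 1) :
    ∃ C : ℝ, ∀ N, (sphere n N).Finite ∧ sphereCount n N * r ^ N ≤ C := by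
  obtain ⟨F, hF⟩ := hP.exists_sphereCode (by omega)
  obtain ⟨C, hC⟩ := ((((isExpBounded_list hP.digitWeight_pos hr hr1 hsum).prod_nat hr hr1).prod_nat
    hr hr1).prod_nat hr hr1).prod_finite (Y := Bool × Bool × Bool)
  refine ⟨C / r ^ 2, fun N => ?_⟩
  obtain ⟨hfin, hle⟩ := hC (N + 2)
  choose geo hgeo hgeo' using exists_length_eq_wordLength n
  choose s hs hs' using fun g => hF (geo g)
  have hmaps : Set.MapsTo s (sphere n N) {x | (((x.1.1.1.1.map fun i => digitWeight (blk i)).sum +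
      x.1.1.1.2) + x.1.1.2) + x.1.2 ≤ N + 2} := by
    intro g hg
    have h1 := hs' g
    rw [hgeo' g, show wordLength n g = N from hg, digitWeight_spell] at h1
    exact h1
  have hinj : Set.InjOn s (sphere n N) := by
    intro g _ g' _ h
    have h1 := (hs g).symm.trans ((congrArg F h).trans (hs g'))
    rw [Prod.mk.injEq] at h1
    rw [← hgeo g, ← hgeo g']
    exact (wordEval_eq_iff hn).2 h1
  refine ⟨hfin.of_injOn hmaps hinj, ?_⟩
  rw [le_div_iff₀ (by positivity), mul_assoc, ← pow_add]
  refine le_trans ?_ hle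
  gcongr
  exact Set.ncard_le_ncard_of_injOn s hmaps hinj hfin

end Code

/-! ### Elements have at most one strict shape 1 geodesic -/

/-- Comparison of two expansions of the same value at the first two places where they differ. -/
lemma exists_first_ne {n : ℕ} (hn : n ≠ 0) {v : ℤ} {x y : ℕ →₀ ℤ} (hx : x ∈ digitLattice n v)
    (hy : y ∈ digitLattice n v) (hne : x ≠ y) :
    ∃ (j : ℕ) (c : ℤ), x j ≠ y j ∧ x j - y j = n * (y (j + 1) - x (j + 1) + n * c) := by
  classical
  have hex : ∃ j, x j ≠ y j := by
    by_contra h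
    push Not at h
    exact hne (Finsupp.ext h)
  obtain ⟨K, hK⟩ : ∃ K, K = lastIndex x + lastIndex y := ⟨_, rfl⟩
  have hj := Nat.find_spec hex
  have hmin : ∀ i < Nat.find hex, x i = y i := fun i hi => by simpa using Nat.find_min hex hi
  generalize Nat.find hex = j at hj hmin
  have hsum : ∑ i ∈ Finset.range (j + (2 + K)), (x i - y i) * (n : ℤ) ^ i = 0 := by
    simp only [sub_mul, Finset.sum_sub_distrib]
    rw [sum_range_of_lastIndex_lt (by omega) (f := fun i d => d * (n : ℤ) ^ i) (by simp),
      sum_range_of_lastIndex_lt (by omega) (f := fun i d => d * (n : ℤ) ^ i) (by simp)]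
    exact sub_eq_zero.2 (Eq.trans hx (Eq.symm hy))
  rw [Finset.sum_range_add, Finset.sum_eq_zero fun i hi => by
    rw [hmin i (Finset.mem_range.1 hi), sub_self, zero_mul], zero_add, Finset.sum_range_add,
    Finset.sum_range_succ, Finset.sum_range_one] at hsum
  refine ⟨j, -∑ i ∈ Finset.range K, (x (j + (2 + i)) - y (j + (2 + i))) * (n : ℤ) ^ i, hj, ?_⟩
  have hn' : (n : ℤ) ^ j ≠ 0 := pow_ne_zero _ (by exact_mod_cast hn)
  have htail : ∑ i ∈ Finset.range K, (x (j + (2 + i)) - y (j + (2 + i))) * (n : ℤ) ^ (j + (2 + i)) =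
      (n : ℤ) ^ j * (n ^ 2 *
        ∑ i ∈ Finset.range K, (x (j + (2 + i)) - y (j + (2 + i))) * (n : ℤ) ^ i) := by
    rw [Finset.mul_sum, Finset.mul_sum]
    exact Finset.sum_congr rfl fun i _ => by ring
  rw [htail] at hsum
  refine mul_left_cancel₀ hn' ?_
  rw [add_zero] at hsum
  linear_combination hsum

lemma absLexLT_or_absLexLT_of_abs_ne {x y : ℕ →₀ ℤ} (h : ∃ i, |x i| ≠ |y i|) :
    AbsLexLT x y ∨ AbsLexLT y x := by
  classical
  have hmin : ∀ i < Nat.find h, |x i| = |y i| := fun i hi => by simpa using Nat.find_min h hi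
  rcases lt_or_gt_of_ne (Nat.find_spec h) with h1 | h1
  · exact Or.inl ⟨_, hmin, h1⟩
  · exact Or.inr ⟨_, fun j hj => (hmin j hj).symm, h1⟩

/-- A minimal vector with `k_x < w` is determined by its value. For `n` even the absolute values of
the digits are determined by the lexicographic minimality; a change of sign of a digit `±n/2` would
change the parity of the next digit. -/
lemma eq_of_isMinimalVector {n u w : ℕ} (hn : 2 ≤ n) {v : ℤ} {x y : ℕ →₀ ℤ}
    (hx : x ∈ box n u v w) (hy : y ∈ box n u v w) (hmx : IsMinimalVector n u v w x)
    (hmy : IsMinimalVector n u v w y) (hkx : lastIndex x < w) (hky : lastIndex y < w) : x = y := by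
  have hbound : ∀ z ∈ box n u v w, lastIndex z < w → ∀ i, |z i| ≤ ((n / 2 : ℕ) : ℤ) := by
    intro z hz hk i
    rcases lt_trichotomy i (lastIndex z) with hi | rfl | hi
    · exact hz.2.1 i hi
    · exact hz.2.2.1 (hk.trans_le (le_max_right _ _))
    · rw [apply_eq_zero_of_lastIndex_lt hi, abs_zero]
      positivity
  by_contra hne
  obtain ⟨j, c, hj, hc⟩ := exists_first_ne (by omega) hx.1 hy.1 hne
  have hxj := abs_le.1 (hbound x hx hkx j)
  have hyj := abs_le.1 (hbound y hy hky j)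
  rcases Nat.even_or_odd n with he | ho
  · have habs : ∀ i, |x i| = |y i| := by
      by_contra h
      push Not at h
      have hlen := le_antisymm (hmx.2.1 y hy.1) (hmy.2.1 x hx.1)
      rcases absLexLT_or_absLexLT_of_abs_ne h with h | h
      · exact hmy.2.2 he x hx.1 hlen h
      · exact hmx.2.2 he y hy.1 hlen.symm h
    have hyx : y j = -x j := by
      rcases abs_eq_abs.1 (habs j) with h | h
      · exact absurd h hj
      · rw [h, neg_neg]
    obtain ⟨e, hpar⟩ : (2 : ℤ) ∣ y (j + 1) - x (j + 1) := by
      rcases abs_eq_abs.1 (habs (j + 1)) with h | h <;> omega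
    obtain ⟨α, rfl⟩ := he.exists_two_nsmul
    rw [hpar, hyx] at hc
    simp only [smul_eq_mul] at *
    push_cast at hc
    have hdvd : x j = 2 * α * (e + α * c) := by linarith
    have h0 : x j = 0 := Int.eq_zero_of_abs_lt_dvd ⟨_, hdvd⟩ (by rw [abs_lt]; omega)
    rw [hyx, h0] at hj
    exact hj rfl
  · obtain ⟨k, hk⟩ := ho
    exact hj (sub_eq_zero.1 (Int.eq_zero_of_abs_lt_dvd ⟨_, hc⟩ (by rw [abs_lt]; omega)))

lemma wordEval_injOn_strictShapeOneGeodesics {n : ℕ} (hn : 2 ≤ n) :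
    Set.InjOn (wordEval n) (strictShapeOneGeodesics n) := by
  have hn0 : n ≠ 0 := by omega
  -- the normal form is unique: `u < u'` would make `v'` divisible by `n`, although `u', w' > 0`
  have key : ∀ {u u' w w' : ℕ} {v v' : ℤ}, IsNormalForm n u' v' w' → 0 < w' →
      (w : ℤ) - u = w' - u' →
      v * (n : ℤ) ^ u' = v' * (n : ℤ) ^ u → u ≤ u' → u = u' := by
    intro u u' w w' v v' hnf hw hh hv hu
    by_contra hne
    obtain ⟨c, rfl⟩ := Nat.exists_eq_add_of_lt (lt_of_le_of_ne hu hne)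
    have hv' : v' = n * (v * (n : ℤ) ^ c) := by
      refine mul_right_cancel₀ (pow_ne_zero u (show (n : ℤ) ≠ 0 by exact_mod_cast hn0)) ?_
      rw [← hv]
      ring
    rcases Nat.mul_eq_zero.1 (hnf ⟨_, hv'⟩) with h | h <;> omega
  rintro _ ⟨u, v, w, x, hnf, hbox, hmin, hk, rfl, -⟩ _ ⟨u', v', w', x', hnf', hbox', hmin', hk',
    rfl, -⟩ h
  obtain ⟨hh, ht⟩ := (wordEval_eq_iff hn).1 h
  obtain ⟨h1, h2⟩ := height_translation_up hn0 u w hbox.1 (eta_of_lastIndex_le hk.le)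
  obtain ⟨h1', h2'⟩ := height_translation_up hn0 u' w' hbox'.1 (eta_of_lastIndex_le hk'.le)
  rw [h1, h1'] at hh
  have hv : v * (n : ℤ) ^ u' = v' * (n : ℤ) ^ u := by
    have : (v : ℚ) * (n : ℚ) ^ u' = v' * (n : ℚ) ^ u := by rw [← h2, ← h2', ht]; ring
    exact_mod_cast this
  obtain rfl : u = u' := by
    rcases le_total u u' with hu | hu
    · exact key hnf' (by omega) hh hv hu
    · exact (key hnf (by omega) hh.symm hv.symm hu).symm
  obtain rfl : w = w' := by omega
  obtain rfl : v = v' :=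
    mul_right_cancel₀ (pow_ne_zero u (show (n : ℤ) ≠ 0 by exact_mod_cast hn0)) hv
  rw [eq_of_isMinimalVector hn hbox hbox' hmin hmin' hk hk']

/-! ### The growth rates -/

lemma languageCount_le_sphereCount {n N : ℕ} (hn : 2 ≤ n) (hfin : (sphere n N).Finite) :
    languageCount n N ≤ sphereCount n N := by
  refine Set.ncard_le_ncard_of_injOn (wordEval n) ?_
    (fun _ h _ h' => wordEval_injOn_strictShapeOneGeodesics hn h.1 h'.1) hfin
  rintro W ⟨⟨u, v, w, x, -, -, -, -, -, hgeo⟩, hlen⟩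
  exact (hgeo.symm.trans hlen : wordLength n (wordEval n W) = N)

lemma finite_length_eq (S : Set Word) (N : ℕ) : {W : Word | W ∈ S ∧ W.length = N}.Finite := by
  have : Finite Gen := Finite.of_injective (fun s => match s with | Gen.a => true | Gen.t => false)
    (by rintro (_ | _) (_ | _) h <;> simp at h ⊢)
  exact (List.finite_length_eq (Gen × Bool) N).subset fun _ h => h.2

lemma IsDigitCode.hasGrowthRate {n : ℕ} {ι : Type} [Fintype ι] {blk : ι → List ℤ}
    (hP : IsDigitCode n blk) (hn : 2 ≤ n) {r : ℝ} (hr : 0 < r) (hr1 : r < 1)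
    (hsum : ∑ i, r ^ digitWeight (blk i) = 1) :
    HasGrowthRate (languageCount n) r⁻¹ ∧ HasGrowthRate (sphereCount n) r⁻¹ := by
  obtain ⟨C, hC⟩ := hP.sphere_bound hn hr hr1 hsum
  obtain ⟨i₀, hi₀⟩ := hP.zero
  obtain ⟨c, hc, hlow⟩ := exists_le_listCount_mul_pow hP.digitWeight_pos (i₀ := i₀)
    (by simp [hi₀, digitWeight]) hr hr1 hsum
  have hle : ∀ N, languageCount n N ≤ sphereCount n N := fun N =>
    languageCount_le_sphereCount hn (hC N).1
  have hge : ∀ N, 1 ≤ N → listCount (fun i => digitWeight (blk i)) N ≤ languageCount n N := by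
    intro N hN
    have hne : ∀ L : List ι, (L.map fun i => digitWeight (blk i)).sum = N → L ≠ [] := by
      rintro L hL rfl
      simp at hL
      omega
    refine Set.ncard_le_ncard_of_injOn (fun L => digitWord (spell blk L)) ?_ ?_
      (finite_length_eq _ N)
    · intro L (hL : (L.map fun i => digitWeight (blk i)).sum = N)
      refine ⟨hP.digitWord_mem_strictShapeOneGeodesics hn (hne L hL), ?_⟩
      rw [length_digitWord (hP.spell_ne_nil (hne L hL)), digitWeight_spell, hL]
    · intro L hL L' hL' h
      exact hP.wordEval_digitWord_injective hn (hne L hL) (hne L' hL') (congrArg _ h)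
  have hle' : ∀ N, (languageCount n N : ℝ) * r ^ N ≤ sphereCount n N * r ^ N := fun N => by
    gcongr
    exact hle N
  have hge' : ∀ N, 1 ≤ N → c ≤ languageCount n N * r ^ N := fun N hN =>
    (hlow N).trans (by gcongr; exact hge N hN)
  exact ⟨hasGrowthRate_of_bounds hr hr1 hc hge' fun N => (hle' N).trans (hC N).2,
    hasGrowthRate_of_bounds hr hr1 hc (fun N hN => (hge' N hN).trans (hle' N)) fun N => (hC N).2⟩

end BSGrowth

theorem mainTheorem1 (n : ℕ) (hn : 2 ≤ n) :
    (Odd n → ∃ r : ℝ, BSGrowth.IsSmallestRoot (BSGrowth.oddPoly (n / 2)) (r : ℂ) ∧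
      BSGrowth.HasGrowthRate (BSGrowth.languageCount n) r⁻¹ ∧
      BSGrowth.HasGrowthRate (BSGrowth.sphereCount n) r⁻¹) ∧
    (Even n → ∃ r : ℝ, BSGrowth.IsSmallestRoot (BSGrowth.evenPoly (n / 2)) (r : ℂ) ∧
      BSGrowth.HasGrowthRate (BSGrowth.languageCount n) r⁻¹ ∧
      BSGrowth.HasGrowthRate (BSGrowth.sphereCount n) r⁻¹) := by
  constructor
  · intro ho
    have hP := BSGrowth.isDigitCode_oddBlock hn ho
    obtain ⟨i₀, hi₀⟩ := hP.zero
    obtain ⟨r, hr, hr1, hsum⟩ :=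
      BSGrowth.exists_sum_pow_eq_one hP.digitWeight_pos hP.one_lt_card
    refine ⟨r, ⟨?_, fun z hz hne => ?_⟩, hP.hasGrowthRate hn hr hr1 hsum⟩
    · rw [BSGrowth.aeval_oddPoly, sub_eq_zero]
      exact_mod_cast hsum.symm
    · rw [BSGrowth.aeval_oddPoly, sub_eq_zero] at hz
      rw [Complex.norm_real, Real.norm_of_nonneg hr.le]
      exact BSGrowth.lt_norm_of_sum_pow_eq_one (i₀ := i₀)
        (by simp [hi₀, BSGrowth.digitWeight]) hsum hz.symm hne
  · intro he
    have hP := BSGrowth.isDigitCode_evenBlock hn he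
    obtain ⟨i₀, hi₀⟩ := hP.zero
    obtain ⟨r, hr, hr1, hsum⟩ :=
      BSGrowth.exists_sum_pow_eq_one hP.digitWeight_pos hP.one_lt_card
    refine ⟨r, ⟨?_, fun z hz hne => ?_⟩, hP.hasGrowthRate hn hr hr1 hsum⟩
    · rw [BSGrowth.aeval_evenPoly hn, mul_eq_zero, sub_eq_zero, sub_eq_zero]
      right
      exact_mod_cast hsum.symm
    · rw [BSGrowth.aeval_evenPoly hn, mul_eq_zero, sub_eq_zero, sub_eq_zero] at hz
      rw [Complex.norm_real, Real.norm_of_nonneg hr.le]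
      rcases hz with rfl | hz
      · simpa using hr1
      · exact BSGrowth.lt_norm_of_sum_pow_eq_one (i₀ := i₀)
          (by simp [hi₀, BSGrowth.digitWeight]) hsum hz.symm hne
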